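/- **Setting.** Let $k\ge 1$. Each of $k$ players holds a set $E_j$ of edges on the vertex set $\{1,\dots,n\}$; the sets may overlap, and the input graph is $G=(V,E)$ with $E=E_1\cup\dots\cup E_k$. The players and a referee share a random string. In a simultaneous protocol each player sends one message, a bit string determined by the player's own input and the random string, and the referee, who has no input, computes an output from the messages and the random string. The graph $G$ is $\epsilon$-far from triangle-free if at least $\epsilon|E|$ edges have to be added or removed to make it triangle-free. A triangle edge of $G$ is an edge contained in a triangle of $G$. Let $T^{\epsilon}_{n,d}$ be the task of outputting a triangle edge of $G$, given the promise that $G$ has $n$ vertices, average degree $2|E|/n=d$, and is $\epsilon$-far from triangle-free. Let $\mathrm{CC}^{sim}_{k,\delta}(T^{\epsilon}_{n,d})$ be the infimum, over all $k$-player simultaneous protocols that on every input satisfying the promise err with probability at most $\delta$, of the maximum over these inputs of the expected total number of bits sent. **Theorem.** There is an absolute constant $\epsilon_0>0$ such that for every $C>0$ there are constants $c>0$ and $N$, depending only on $C$, with the following property. Let $n\in\mathbb N$ and let $d$ be a real number such that $nd$ is an even non-negative integer, $nd\ge N$, and $d\le C\sqrt n$. Then for all $0<\epsilon\le\epsilon_0$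 and all $\delta<1/100$: 1. for every $k>3$, $\ \mathrm{CC}^{sim}_{k,\delta}(T^{\epsilon}_{n,d})\ \ge\ c\cdot k\cdot (nd)^{1/6}$; 2. $\mathrm{CC}^{sim}_{3,\delta}(T^{\epsilon}_{n,d})\ \ge\ c\cdot (nd)^{1/3}$. -/

import Mathlib

open MeasureTheory
open scoped ENNReal

/-- A distributed search problem with promise for `k` players: player `j` receives `x j : X`, the
input tuple is promised to lie in `valid`, and `correct x y` says that the output `y` is an
acceptable answer on the input tuple `x`. -/
structure SearchProblem (k : ℕ) (X Y : Type) where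
  valid : Set (Fin k → X)
  correct : (Fin k → X) → Y → Prop

/-- A simultaneous protocol for `k` players with shared randomness. A random string `ω` is drawn
from a probability space `Ω`. Each player `j` sends a single message, a bit string that depends
only on `ω` and on the player's own input. The referee, who has no input, computes the output from
`ω` and the `k` messages. The last two fields say that messages and output are measurable in `ω`. -/
structure SimProtocol (k : ℕ) (X Y : Type) where
  Ω : Type
  mΩ : MeasurableSpace Ω
  prob : Measure Ω
  isProb : IsProbabilityMeasure prob
  msg : Fin k → Ω → X → List Bool
  out : Ω → (Fin k → List Bool) → Y
  measurable_msg : ∀ (j : Fin k) (x : X) (s : List Bool), MeasurableSet {ω | msg j ω x = s}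
  measurable_out : ∀ (s : Fin k → List Bool) (y : Y), MeasurableSet {ω | out ω s = y}

namespace SimProtocol

variable {k : ℕ} {X Y : Type}

/-- The output of the referee on the input tuple `x` when the shared random string is `ω`. -/
def run (p : SimProtocol k X Y) (ω : p.Ω) (x : Fin k → X) : Y :=
  p.out ω (fun j => p.msg j ω (x j))

/-- The probability that the output on the input tuple `x` is not correct. -/
noncomputable def errorProb (p : SimProtocol k X Y) (T : SearchProblem k X Y)
    (x : Fin k → X) : ℝ :=
  (@Measure.real p.Ω p.mΩ p.prob) {ω | ¬ T.correct x (p.run ω x)}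

/-- The protocol solves `T` with worst-case error at most `δ`. -/
def Solves (p : SimProtocol k X Y) (T : SearchProblem k X Y) (δ : ℝ) : Prop :=
  ∀ x ∈ T.valid, p.errorProb T x ≤ δ

/-- The expected total number of bits sent by the players on the input tuple `x`. -/
noncomputable def expectedBits (p : SimProtocol k X Y) (x : Fin k → X) : ℝ≥0∞ :=
  @lintegral p.Ω p.mΩ p.prob (fun ω => ∑ j : Fin k, ((p.msg j ω (x j)).length : ℝ≥0∞))

/-- The communication complexity of a protocol: the maximum, over the inputs of the problem, of the
expected number of bits sent. -/
noncomputable def cost (p : SimProtocol k X Y) (T : SearchProblem k X Y) : ℝ≥0∞ :=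
  ⨆ x ∈ T.valid, p.expectedBits x

end SimProtocol

/-- The simultaneous communication complexity of `T` with error `δ`: the least cost of a
simultaneous protocol that solves `T` with worst-case error at most `δ`. -/
noncomputable def simCC {k : ℕ} {X Y : Type} (T : SearchProblem k X Y) (δ : ℝ) : ℝ≥0∞ :=
  ⨅ (p : SimProtocol k X Y) (_ : p.Solves T δ), p.cost T

/-- The average degree `2|E|/n` of a graph on `n` vertices. -/
noncomputable def avgDegree {n : ℕ} (G : SimpleGraph (Fin n)) : ℝ :=
  2 * (G.edgeSet.ncard : ℝ) / n

/-- `G` is `ε`-far from triangle-free: at least `ε|E|` edges have to be added or removed to turn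
`G` into a triangle-free graph. -/
def FarFromTriFree {n : ℕ} (ε : ℝ) (G : SimpleGraph (Fin n)) : Prop :=
  ∀ H : SimpleGraph (Fin n), H.CliqueFree 3 →
    ε * (G.edgeSet.ncard : ℝ) ≤ ((symmDiff G.edgeSet H.edgeSet).ncard : ℝ)

/-- `e` is a triangle edge of `G`: an edge of some triangle of `G`. -/
def IsTriangleEdge {n : ℕ} (G : SimpleGraph (Fin n)) (e : Sym2 (Fin n)) : Prop :=
  ∃ u v w : Fin n, e = s(u, v) ∧ G.Adj u v ∧ G.Adj v w ∧ G.Adj u w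

/-- The task of finding a triangle edge in graphs on `n` vertices of average degree `d` that are
`ε`-far from triangle-free. Player `j` receives the edges of `E j`; the sets of edges of different
players may overlap, and the input graph is their union `⨆ j, E j`. -/
def triangleEdgeTask (k n : ℕ) (ε d : ℝ) :
    SearchProblem k (SimpleGraph (Fin n)) (Sym2 (Fin n)) where
  valid := {E | avgDegree (⨆ j, E j) = d ∧ FarFromTriFree ε (⨆ j, E j)}
  correct := fun E e => IsTriangleEdge (⨆ j, E j) e

/-!
Why finding a triangle edge needs long messages.

*The hard inputs.* Take a tripartite graph that is a union of edge-disjoint blocks `K_{r,r,r}` such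
that every triangle lies inside a block, give each player one of the three classes of edges, and
keep every edge independently with probability `q`, where `r q² = 1/100`. An edge is then expected to lie
in `1/100` triangles, while the number of edge-disjoint triangles is a constant fraction of the
number of edges (`prob_valid_ge`, by a second moment computation). A single block would do for small
average degree. To reach `d = C √n` for every `C` with the same `ε₀`, the blocks are indexed by the
progressions in `(ℤ/3)^D` whose difference lies in `{0, 1}^D`, and `D` grows with `C`: since
`{0, 1}^D` contains no nontrivial solution of `x + y + z = 0`, triangles do not leave the blocks
(`pos_triangle`), and the `6 ^ D` blocks use only `3 ^ (D + 1) r` vertices. Each player pads its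
input to a prescribed number of edges by edges of a bipartite graph on extra vertices, so that the
number of edges of the union is exact.

*Messages reveal little.* Condition on a message about one class, and consider by how much the
posterior probability of each edge exceeds `2 q`. The expected sum of these excesses is at most the
logarithm of the number of messages (`sum_sum_excess_le`), and the expected excess of each edge is
at most `q`. Given the messages the classes are independent, so that the probability that the
referee's edge lies in a triangle is bounded by posterior probabilities (`hitProb_le_sum`).

*Three players.* Up to small terms, the success probability is a constant that comes from the prior,
plus `∑ a b c` over the potential triangles, where `a, b, c` are the expected excesses. By
Cauchy–Schwarz (`sq_sum_triangles_le`) this sum is at most `(q l) ^ (3 / 2)` for messages of `l`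
bits, which is small unless `l` is of order `1 / q ≈ √r ≈ (n d) ^ (1 / 3)`.

*Many players.* Give one class to a single player, a second class to another single player, and the
third class to all others. The referee then learns at most the whole third class and two messages,
and succeeds with small probability unless `q l²` is of order one (`success_le_oneWay`), that is,
unless `l` is of order `(n d) ^ (1 / 6)`. The two players can be chosen among those whose messages
are short, of at most about `1 / k` of the total length (`exists_longValid_le`).
-/

set_option linter.unusedSectionVars false

namespace TriangleEdge

/-! ### Independent random bits and messages about them -/

/-- The indicator of a bit as a real number. -/
def ind (b : Bool) : ℝ := if b then 1 else 0

lemma ind_nonneg (b : Bool) : 0 ≤ ind b := by cases b <;> simp [ind]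

lemma ind_le_one (b : Bool) : ind b ≤ 1 := by cases b <;> simp [ind]

section Weight

variable {E : Type*} [Fintype E]

/-- The probability of `x : E → Bool` when the bits are independent, each equal to `true` with
probability `q`. -/
noncomputable def bernWeight (q : ℝ) (x : E → Bool) : ℝ := ∏ e, if x e then q else 1 - q

lemma bernWeight_nonneg {q : ℝ} (h0 : 0 ≤ q) (h1 : q ≤ 1) (x : E → Bool) :
    0 ≤ bernWeight q x :=
  Finset.prod_nonneg fun e _ => by split_ifs <;> linarith

variable [DecidableEq E]

lemma sum_bernWeight_mul_prod (q : ℝ) (f : E → Bool → ℝ) :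
    ∑ x : E → Bool, bernWeight q x * ∏ e, f e (x e)
      = ∏ e, (q * f e true + (1 - q) * f e false) := by
  have h := Finset.prod_univ_sum (fun _ : E => (Finset.univ : Finset Bool))
    (fun e b => (if b then q else 1 - q) * f e b)
  simp only [Fintype.piFinset_univ, Fintype.sum_bool, if_true] at h
  simp only [bernWeight, ← Finset.prod_mul_distrib]
  simpa using h.symm

lemma sum_bernWeight_mul_prod_finset (q : ℝ) (S : Finset E) (g : Bool → ℝ) :
    ∑ x : E → Bool, bernWeight q x * ∏ e ∈ S, g (x e)
      = (q * g true + (1 - q) * g false) ^ S.card := by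
  have h := sum_bernWeight_mul_prod q (fun (e : E) b => if e ∈ S then g b else 1)
  simp only [Finset.prod_ite_mem, Finset.univ_inter] at h
  rw [h, ← Finset.prod_const]
  rw [← Finset.prod_subset (Finset.subset_univ S)]
  · exact Finset.prod_congr rfl fun e he => by simp [he]
  · intro e _ he
    simp [he]

lemma sum_bernWeight (q : ℝ) : ∑ x : E → Bool, bernWeight q x = 1 := by
  simpa using sum_bernWeight_mul_prod_finset q (∅ : Finset E) (fun _ => 1)

lemma sum_bernWeight_mul_ind (q : ℝ) (e : E) :
    ∑ x : E → Bool, bernWeight q x * ind (x e) = q := by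
  simpa [ind] using sum_bernWeight_mul_prod_finset q {e} ind

/-- The second moments of the bits: `ℙ(x e = x e' = true)`. -/
lemma sum_bernWeight_mul_ind_mul_ind (q : ℝ) (e e' : E) :
    ∑ x : E → Bool, bernWeight q x * (ind (x e) * ind (x e')) = if e = e' then q else q ^ 2 := by
  by_cases h : e = e'
  · subst h
    have h2 : ∀ b, ind b * ind b = ind b := by intro b; cases b <;> simp [ind]
    simp only [h2, if_true, sum_bernWeight_mul_ind]
  · have := sum_bernWeight_mul_prod_finset q {e, e'} ind
    rw [Finset.card_pair h] at this
    simp only [Finset.prod_pair h] at this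
    rw [this, if_neg h]
    simp [ind]

lemma sum_bernWeight_mul_exp_le {q : ℝ} (h0 : 0 ≤ q) (S : Finset E) :
    ∑ x : E → Bool, bernWeight q x * Real.exp (∑ e ∈ S, ind (x e))
      ≤ Real.exp (2 * q * S.card) := by
  simp only [Real.exp_sum]
  rw [sum_bernWeight_mul_prod_finset q S (fun b => Real.exp (ind b)), mul_comm (2 * q),
    Real.exp_nat_mul]
  have h3 : Real.exp 1 ≤ 3 := by linarith [Real.exp_one_lt_d9]
  have he : 1 ≤ Real.exp 1 := Real.one_le_exp zero_le_one
  have h4 : q * Real.exp (ind true) + (1 - q) * Real.exp (ind false)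
      = 1 + q * (Real.exp 1 - 1) := by
    simp [ind]; ring
  rw [h4]
  refine pow_le_pow_left₀ (by nlinarith) ?_ _
  have := Real.add_one_le_exp (2 * q)
  nlinarith

end Weight

section Fiber

variable {E M : Type*} [Fintype E] [DecidableEq E] [DecidableEq M]

/-- The probability of the message `m`, when the message is the function `g` of the random bits. -/
noncomputable def fibWeight (q : ℝ) (g : (E → Bool) → M) (m : M) : ℝ :=
  ∑ x, if g x = m then bernWeight q x else 0

/-- The probability that the message is `m` and the bit at `e` is `true`. -/
noncomputable def fibBit (q : ℝ) (g : (E → Bool) → M) (m : M) (e : E) : ℝ :=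
  ∑ x, if g x = m then bernWeight q x * ind (x e) else 0

/-- The excess at `e` of the message `m`: by how much the posterior probability of the bit at `e`
exceeds twice its prior probability `q`, weighted with the probability of `m`. -/
noncomputable def excess (q : ℝ) (g : (E → Bool) → M) (m : M) (e : E) : ℝ :=
  max (fibBit q g m e - 2 * q * fibWeight q g m) 0

variable {q : ℝ} (g : (E → Bool) → M)

lemma excess_nonneg (m : M) (e : E) : 0 ≤ excess q g m e := le_max_right _ _

lemma fibBit_le_add_excess (m : M) (e : E) :
    fibBit q g m e ≤ 2 * q * fibWeight q g m + excess q g m e := by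
  have := le_max_left (fibBit q g m e - 2 * q * fibWeight q g m) 0
  unfold excess
  linarith

lemma fibWeight_nonneg (h0 : 0 ≤ q) (h1 : q ≤ 1) (m : M) : 0 ≤ fibWeight q g m :=
  Finset.sum_nonneg fun x _ => by
    split_ifs
    · exact bernWeight_nonneg h0 h1 x
    · exact le_rfl

lemma fibBit_nonneg (h0 : 0 ≤ q) (h1 : q ≤ 1) (m : M) (e : E) : 0 ≤ fibBit q g m e :=
  Finset.sum_nonneg fun x _ => by
    split_ifs
    · exact mul_nonneg (bernWeight_nonneg h0 h1 x) (ind_nonneg _)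
    · exact le_rfl

lemma fibBit_le_fibWeight (h0 : 0 ≤ q) (h1 : q ≤ 1) (m : M) (e : E) :
    fibBit q g m e ≤ fibWeight q g m :=
  Finset.sum_le_sum fun x _ => by
    split_ifs
    · exact mul_le_of_le_one_right (bernWeight_nonneg h0 h1 x) (ind_le_one _)
    · exact le_rfl

lemma excess_le_fibBit (h0 : 0 ≤ q) (h1 : q ≤ 1) (m : M) (e : E) :
    excess q g m e ≤ fibBit q g m e := by
  refine max_le ?_ (fibBit_nonneg g h0 h1 m e)
  nlinarith [fibWeight_nonneg g h0 h1 m]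

variable [Fintype M]

lemma sum_fibWeight : ∑ m, fibWeight q g m = 1 := by
  unfold fibWeight
  rw [Finset.sum_comm]
  simp [sum_bernWeight]

lemma sum_fibBit (e : E) : ∑ m, fibBit q g m e = q := by
  unfold fibBit
  rw [Finset.sum_comm]
  simp [sum_bernWeight_mul_ind]

lemma sum_excess_le (h0 : 0 ≤ q) (h1 : q ≤ 1) (e : E) : ∑ m, excess q g m e ≤ q := by
  exact (Finset.sum_le_sum fun m _ => excess_le_fibBit g h0 h1 m e).trans_eq (sum_fibBit g e)

/-- The total excess of a message is at most the logarithm of the number of messages. This is the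
only place where the length of the messages enters. It is a form of the variational inequality for
relative entropy, obtained from `t + 1 ≤ exp t`. -/
lemma sum_sum_excess_le (h0 : 0 ≤ q) (h1 : q ≤ 1) [Nonempty M] :
    ∑ m, ∑ e, excess q g m e ≤ Real.log (Fintype.card M) := by
  set K : ℝ := (Fintype.card M : ℝ) with hK
  have hKpos : 0 < K := by rw [hK]; exact_mod_cast Fintype.card_pos
  have key : ∀ m, ∑ e, excess q g m e ≤ (Real.log K - 1) * fibWeight q g m + 1 / K := by
    intro m
    set S : Finset E := Finset.univ.filter fun e => 2 * q * fibWeight q g m < fibBit q g m e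
    have hS : ∑ e, excess q g m e = ∑ e ∈ S, (fibBit q g m e - 2 * q * fibWeight q g m) := by
      rw [Finset.sum_filter]
      refine Finset.sum_congr rfl fun e _ => ?_
      unfold excess
      split_ifs with h
      · exact max_eq_left (by linarith)
      · exact max_eq_right (by linarith)
    rw [hS, Finset.sum_sub_distrib, Finset.sum_const, nsmul_eq_mul]
    set a : ℝ := Real.log K + 2 * q * S.card with ha
    -- bound the number of `true` bits in `S` by the tangent line of `exp` at `a`
    have hN : ∑ e ∈ S, fibBit q g m e ≤ (a - 1) * fibWeight q g m +
        Real.exp (-a) * ∑ x, bernWeight q x * Real.exp (∑ e ∈ S, ind (x e)) := by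
      unfold fibBit fibWeight
      rw [Finset.sum_comm, Finset.mul_sum, Finset.mul_sum, ← Finset.sum_add_distrib]
      refine Finset.sum_le_sum fun x _ => ?_
      have hw := bernWeight_nonneg h0 h1 x
      split_ifs with h
      · rw [← Finset.mul_sum]
        have ht := Real.add_one_le_exp (-a + ∑ e ∈ S, ind (x e))
        rw [Real.exp_add] at ht
        nlinarith
      · simp only [Finset.sum_const_zero, mul_zero, zero_add]
        positivity
    have hexp : Real.exp (-a) * ∑ x, bernWeight q x * Real.exp (∑ e ∈ S, ind (x e)) ≤ 1 / K := by
      refine (mul_le_mul_of_nonneg_left (sum_bernWeight_mul_exp_le h0 S)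
        (Real.exp_pos _).le).trans (le_of_eq ?_)
      rw [← Real.exp_add, ha]
      have : -(Real.log K + 2 * q * S.card) + 2 * q * S.card = - Real.log K := by ring
      rw [this, Real.exp_neg, Real.exp_log hKpos, one_div]
    have : (a - 1) * fibWeight q g m - S.card * (2 * q * fibWeight q g m)
        = (Real.log K - 1) * fibWeight q g m := by rw [ha]; ring
    linarith
  refine (Finset.sum_le_sum fun m _ => key m).trans (le_of_eq ?_)
  rw [Finset.sum_add_distrib, ← Finset.mul_sum, sum_fibWeight, Finset.sum_const, nsmul_eq_mul,
    Finset.card_univ, ← hK]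
  field_simp
  ring

end Fiber

/-! ### The success probability of the referee -/

section Hit

variable {E R MO MF MS : Type*} [Fintype E] [DecidableEq E] [Fintype R]
  [Fintype MO] [DecidableEq MO] [Fintype MF] [DecidableEq MF] [Fintype MS] [DecidableEq MS]

/-- The edge `e` of the first class is present in `x` and lies in a triangle, whose other two edges
`φ e v` and `ψ e v` are present in `y` and in `z`; here `v` is the third vertex of the triangle. -/
def hit (φ ψ : E → R → E) (e : E) (x y z : E → Bool) : Bool :=
  x e && decide (∃ v, y (φ e v) = true ∧ z (ψ e v) = true)

/-- The probability that the edge which the referee computes from the three messages lies in a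
triangle. -/
noncomputable def hitProb (q : ℝ) (φ ψ : E → R → E) (o : MO → MF → MS → E)
    (gO : (E → Bool) → MO) (gF : (E → Bool) → MF) (gS : (E → Bool) → MS) : ℝ :=
  ∑ x, bernWeight q x * ∑ y, bernWeight q y * ∑ z, bernWeight q z *
    ind (hit φ ψ (o (gO x) (gF y) (gS z)) x y z)

lemma ind_hit_le (φ ψ : E → R → E) (e : E) (x y z : E → Bool) :
    ind (hit φ ψ e x y z) ≤ ind (x e) := by
  unfold hit
  cases x e
  · simp
  · exact (ind_le_one _).trans (by simp [ind])

lemma ind_hit_le_sum (φ ψ : E → R → E) (e : E) (x y z : E → Bool) :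
    ind (hit φ ψ e x y z) ≤ ind (x e) * ∑ v, ind (y (φ e v)) * ind (z (ψ e v)) := by
  have hn : ∀ v, 0 ≤ ind (y (φ e v)) * ind (z (ψ e v)) := fun v =>
    mul_nonneg (ind_nonneg _) (ind_nonneg _)
  unfold hit
  cases hx : x e
  · simp [ind]
  · by_cases h : ∃ v, y (φ e v) = true ∧ z (ψ e v) = true
    · obtain ⟨v, hy, hz⟩ := h
      have h1 := Finset.single_le_sum (fun v _ => hn v) (Finset.mem_univ v)
      simp only [hy, hz] at h1
      refine (ind_le_one _).trans ?_
      simpa [ind] using h1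
    · have := Finset.sum_nonneg fun v (_ : v ∈ Finset.univ) => hn v
      simpa [h, ind] using this

lemma sum_mul_comp_eq_sum_fiber {X M : Type*} [Fintype X] [Fintype M] [DecidableEq M] (w : X → ℝ)
    (g : X → M) (F : M → X → ℝ) :
    ∑ x, w x * F (g x) x = ∑ m, ∑ x, (if g x = m then w x else 0) * F m x := by
  rw [Finset.sum_comm]
  refine Finset.sum_congr rfl fun x _ => ?_
  simp [ite_mul]

lemma sum_sum_sum_mul {A B C : Type*} [Fintype A] [Fintype B] [Fintype C] (f : A → ℝ) (g : B → ℝ)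
    (h : C → ℝ) : ∑ a, ∑ b, ∑ c, f a * g b * h c = (∑ a, f a) * (∑ b, g b) * ∑ c, h c := by
  simp only [← Finset.mul_sum, ← Finset.sum_mul]

variable {q : ℝ} {φ ψ : E → R → E} (o : MO → MF → MS → E)
    (gO : (E → Bool) → MO) (gF : (E → Bool) → MF) (gS : (E → Bool) → MS)

/-- Given the messages, the three classes of edges are independent, so that the probability of
success is bounded by the posterior probabilities of the bits. -/
lemma hitProb_le_sum (h0 : 0 ≤ q) (h1 : q ≤ 1) (B : MO → MF → MS → ℝ)
    (hB : ∀ a b c, fibBit q gO a (o a b c) * min (fibWeight q gF b * fibWeight q gS c)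
      (∑ v, fibBit q gF b (φ (o a b c) v) * fibBit q gS c (ψ (o a b c) v)) ≤ B a b c) :
    hitProb q φ ψ o gO gF gS ≤ ∑ a, ∑ b, ∑ c, B a b c := by
  unfold hitProb
  rw [sum_mul_comp_eq_sum_fiber (bernWeight q) gO (fun a x => ∑ y, bernWeight q y *
    ∑ z, bernWeight q z * ind (hit φ ψ (o a (gF y) (gS z)) x y z))]
  refine Finset.sum_le_sum fun a _ => ?_
  have e1 : ∀ x, (∑ y, bernWeight q y * ∑ z, bernWeight q z *
        ind (hit φ ψ (o a (gF y) (gS z)) x y z))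
      = ∑ b, ∑ y, (if gF y = b then bernWeight q y else 0) * ∑ z, bernWeight q z *
        ind (hit φ ψ (o a b (gS z)) x y z) := fun x =>
    sum_mul_comp_eq_sum_fiber (bernWeight q) gF (fun b y => ∑ z, bernWeight q z *
        ind (hit φ ψ (o a b (gS z)) x y z))
  have e2 : ∀ b x y, (∑ z, bernWeight q z * ind (hit φ ψ (o a b (gS z)) x y z))
      = ∑ c, ∑ z, (if gS z = c then bernWeight q z else 0) *
        ind (hit φ ψ (o a b c) x y z) := fun b x y =>
    sum_mul_comp_eq_sum_fiber (bernWeight q) gS (fun c z => ind (hit φ ψ (o a b c) x y z))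
  simp only [e1]
  simp only [e2, Finset.mul_sum]
  rw [Finset.sum_comm]
  refine Finset.sum_le_sum fun b _ => ?_
  have e4 : ∀ x, (∑ y, ∑ c, ∑ z, (if gO x = a then bernWeight q x else 0) *
        ((if gF y = b then bernWeight q y else 0) *
          ((if gS z = c then bernWeight q z else 0) * ind (hit φ ψ (o a b c) x y z))))
        = ∑ c, ∑ y, ∑ z, (if gO x = a then bernWeight q x else 0) *
        ((if gF y = b then bernWeight q y else 0) *
          ((if gS z = c then bernWeight q z else 0) * ind (hit φ ψ (o a b c) x y z))) :=
    fun _ => Finset.sum_comm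
  simp only [e4]
  rw [Finset.sum_comm]
  refine Finset.sum_le_sum fun c _ => le_trans ?_ (hB a b c)
  set e := o a b c
  have hO : ∀ x : E → Bool, 0 ≤ (if gO x = a then bernWeight q x else 0) := fun x => by
    split_ifs
    · exact bernWeight_nonneg h0 h1 x
    · exact le_rfl
  have hF : ∀ x : E → Bool, 0 ≤ (if gF x = b then bernWeight q x else 0) := fun x => by
    split_ifs
    · exact bernWeight_nonneg h0 h1 x
    · exact le_rfl
  have hS : ∀ x : E → Bool, 0 ≤ (if gS x = c then bernWeight q x else 0) := fun x => by
    split_ifs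
    · exact bernWeight_nonneg h0 h1 x
    · exact le_rfl
  have fO : fibBit q gO a e = ∑ x, (if gO x = a then bernWeight q x else 0) * ind (x e) := by
    simp [fibBit, ite_mul]
  have fF : ∀ e', fibBit q gF b e' = ∑ x, (if gF x = b then bernWeight q x else 0) * ind (x e') :=
    fun e' => by simp [fibBit, ite_mul]
  have fS : ∀ e', fibBit q gS c e' = ∑ x, (if gS x = c then bernWeight q x else 0) * ind (x e') :=
    fun e' => by simp [fibBit, ite_mul]
  rw [mul_min_of_nonneg _ _ (fibBit_nonneg gO h0 h1 a e)]
  refine le_min ?_ ?_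
  · rw [fO, fibWeight, fibWeight, ← mul_assoc, ← sum_sum_sum_mul]
    refine Finset.sum_le_sum fun x _ => Finset.sum_le_sum fun y _ => Finset.sum_le_sum fun z _ => ?_
    have h := ind_hit_le φ ψ e x y z
    have := mul_le_mul_of_nonneg_left h (mul_nonneg (hO x) (mul_nonneg (hF y) (hS z)))
    linarith
  · rw [Finset.mul_sum]
    have : ∀ v, fibBit q gO a e * (fibBit q gF b (φ e v) * fibBit q gS c (ψ e v))
        = ∑ x, ∑ y, ∑ z, ((if gO x = a then bernWeight q x else 0) * ind (x e)) *
          ((if gF y = b then bernWeight q y else 0) * ind (y (φ e v))) *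
          ((if gS z = c then bernWeight q z else 0) * ind (z (ψ e v))) := fun v => by
      rw [sum_sum_sum_mul, fO, fF, fS, mul_assoc]
    simp only [this]
    conv_rhs => rw [Finset.sum_comm]
    refine Finset.sum_le_sum fun x _ => ?_
    conv_rhs => rw [Finset.sum_comm]
    refine Finset.sum_le_sum fun y _ => ?_
    conv_rhs => rw [Finset.sum_comm]
    refine Finset.sum_le_sum fun z _ => ?_
    have h := ind_hit_le_sum φ ψ e x y z
    have := mul_le_mul_of_nonneg_left h (mul_nonneg (hO x) (mul_nonneg (hF y) (hS z)))
    refine le_trans (le_of_eq (by ring)) (this.trans (le_of_eq ?_))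
    rw [Finset.mul_sum, Finset.mul_sum]
    exact Finset.sum_congr rfl fun v _ => by ring

/-- Exchanging the roles of the two other edges of the triangles. -/
lemma hitProb_swap :
    hitProb q φ ψ o gO gF gS = hitProb q ψ φ (fun a c b => o a b c) gO gS gF := by
  unfold hitProb
  refine Finset.sum_congr rfl fun x _ => ?_
  congr 1
  simp only [Finset.mul_sum]
  rw [Finset.sum_comm]
  refine Finset.sum_congr rfl fun z _ => Finset.sum_congr rfl fun y _ => ?_
  have : hit φ ψ (o (gO x) (gF y) (gS z)) x y z = hit ψ φ (o (gO x) (gF y) (gS z)) x z y := by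
    simp [hit, and_comm]
  rw [this]
  ring

end Hit

section Bounds

variable {E R MO MF MS : Type*} [Fintype E] [DecidableEq E] [Fintype R]
  [Fintype MO] [DecidableEq MO] [Fintype MF] [DecidableEq MF] [Fintype MS] [DecidableEq MS]
  {q : ℝ} {φ ψ : E → R → E} (o : MO → MF → MS → E)
  (gO : (E → Bool) → MO) (gF : (E → Bool) → MF) (gS : (E → Bool) → MS)

lemma sum_comp_le_of_injective {f : R → E} (hf : Function.Injective f) {a : E → ℝ}
    (ha : ∀ e, 0 ≤ a e) : ∑ v, a (f v) ≤ ∑ e, a e := by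
  classical
  rw [← Finset.sum_image (s := Finset.univ) (f := a) fun x _ y _ h => hf h]
  exact Finset.sum_le_sum_of_subset_of_nonneg (Finset.subset_univ _) fun e _ _ => ha e

/-- The expected number of paths `φ e v, ψ e v`, in terms of the excess of the messages. -/
lemma sum_fibBit_mul_fibBit_le (h0 : 0 ≤ q) (h1 : q ≤ 1)
    (hφ : ∀ e, Function.Injective (φ e)) (hψ : ∀ e, Function.Injective (ψ e))
    (b : MF) (c : MS) (e : E) :
    ∑ v, fibBit q gF b (φ e v) * fibBit q gS c (ψ e v)
      ≤ 4 * q ^ 2 * Fintype.card R * (fibWeight q gF b * fibWeight q gS c)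
        + 2 * q * (fibWeight q gF b * ∑ e', excess q gS c e')
        + 2 * q * ((∑ e', excess q gF b e') * fibWeight q gS c)
        + ∑ v, excess q gF b (φ e v) * excess q gS c (ψ e v) := by
  have hF := fibWeight_nonneg gF h0 h1 b
  have hS := fibWeight_nonneg gS h0 h1 c
  have s1 := sum_comp_le_of_injective (hφ e) fun e' => excess_nonneg (q := q) gF b e'
  have s2 := sum_comp_le_of_injective (hψ e) fun e' => excess_nonneg (q := q) gS c e'
  have step : ∑ v, fibBit q gF b (φ e v) * fibBit q gS c (ψ e v)
      ≤ ∑ v, (4 * q ^ 2 * (fibWeight q gF b * fibWeight q gS c)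
        + 2 * q * fibWeight q gF b * excess q gS c (ψ e v)
        + 2 * q * fibWeight q gS c * excess q gF b (φ e v)
        + excess q gF b (φ e v) * excess q gS c (ψ e v)) := by
    refine Finset.sum_le_sum fun v _ => ?_
    have := mul_le_mul (fibBit_le_add_excess (q := q) gF b (φ e v))
      (fibBit_le_add_excess (q := q) gS c (ψ e v)) (fibBit_nonneg gS h0 h1 c _)
      (add_nonneg (by positivity) (excess_nonneg gF b _))
    refine this.trans (le_of_eq (by ring))
  refine step.trans ?_
  rw [Finset.sum_add_distrib, Finset.sum_add_distrib, Finset.sum_add_distrib, Finset.sum_const,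
    ← Finset.mul_sum, ← Finset.mul_sum, nsmul_eq_mul, Finset.card_univ]
  have t1 := mul_le_mul_of_nonneg_left s1 (by positivity : 0 ≤ 2 * q * fibWeight q gS c)
  have t2 := mul_le_mul_of_nonneg_left s2 (by positivity : 0 ≤ 2 * q * fibWeight q gF b)
  linarith

lemma sum_sum_sum_mul_excess (a : MO → E → ℝ) (b : MF → E → ℝ) (c : MS → E → ℝ) :
    ∑ i, ∑ j, ∑ k, ∑ e, ∑ v, a i e * (b j (φ e v) * c k (ψ e v))
      = ∑ e, ∑ v, (∑ i, a i e) * ((∑ j, b j (φ e v)) * ∑ k, c k (ψ e v)) := by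
  have : ∀ e v, (∑ i, a i e) * ((∑ j, b j (φ e v)) * ∑ k, c k (ψ e v))
      = ∑ i, ∑ j, ∑ k, a i e * (b j (φ e v) * c k (ψ e v)) := fun e v => by
    rw [← mul_assoc, ← sum_sum_sum_mul]
    simp only [mul_assoc]
  simp only [this]
  have c1 : ∀ e, (∑ v, ∑ i, ∑ j, ∑ k, a i e * (b j (φ e v) * c k (ψ e v)))
      = ∑ i, ∑ j, ∑ k, ∑ v, a i e * (b j (φ e v) * c k (ψ e v)) := fun e => by
    rw [Finset.sum_comm]
    refine Finset.sum_congr rfl fun i _ => ?_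
    rw [Finset.sum_comm]
    refine Finset.sum_congr rfl fun j _ => ?_
    rw [Finset.sum_comm]
  simp only [c1]
  symm
  rw [Finset.sum_comm]
  refine Finset.sum_congr rfl fun i _ => ?_
  rw [Finset.sum_comm]
  refine Finset.sum_congr rfl fun j _ => ?_
  rw [Finset.sum_comm]

/-- The success probability of a simultaneous protocol. The term `κ` bounds the sum, over all
potential triangles, of the product of the expected excesses of the three edges; the hypothesis
`hCS` is the Cauchy–Schwarz inequality for this sum. -/
lemma hitProb_le_simultaneous [Nonempty MO] [Nonempty MF] [Nonempty MS]
    (h0 : 0 ≤ q) (h1 : q ≤ 1)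
    (hφ : ∀ e, Function.Injective (φ e)) (hψ : ∀ e, Function.Injective (ψ e))
    (hCS : ∀ a b c : E → ℝ, (∑ e, ∑ v, a e * (b (φ e v) * c (ψ e v))) ^ 2
      ≤ (∑ e, a e ^ 2) * (∑ e, b e ^ 2) * ∑ e, c e ^ 2)
    {l κ : ℝ} (hO : Real.log (Fintype.card MO) ≤ l) (hF : Real.log (Fintype.card MF) ≤ l)
    (hS : Real.log (Fintype.card MS) ≤ l) (hκ : 0 ≤ κ) (hl : (q * l) ^ 3 ≤ κ ^ 2) :
    hitProb q φ ψ o gO gF gS ≤ 2 * q + 4 * q ^ 2 * Fintype.card R + 4 * q * l + κ := by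
  have lO := (sum_sum_excess_le gO h0 h1).trans hO
  have lF := (sum_sum_excess_le gF h0 h1).trans hF
  have lS := (sum_sum_excess_le gS h0 h1).trans hS
  refine (hitProb_le_sum o gO gF gS h0 h1 (fun a b c =>
    2 * q * (fibWeight q gO a * fibWeight q gF b * fibWeight q gS c)
    + 4 * q ^ 2 * Fintype.card R * (fibWeight q gO a * fibWeight q gF b * fibWeight q gS c)
    + 2 * q * (fibWeight q gO a * fibWeight q gF b * ∑ e', excess q gS c e')
    + 2 * q * (fibWeight q gO a * (∑ e', excess q gF b e') * fibWeight q gS c)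
    + ∑ e, ∑ v, excess q gO a e * (excess q gF b (φ e v) * excess q gS c (ψ e v))) ?_).trans ?_
  · intro a b c
    set e := o a b c
    have nF := fibWeight_nonneg gF h0 h1 b
    have nS := fibWeight_nonneg gS h0 h1 c
    have nO := fibWeight_nonneg gO h0 h1 a
    have nX := excess_nonneg (q := q) gO a e
    have nXF : 0 ≤ ∑ e', excess q gF b e' := Finset.sum_nonneg fun e' _ => excess_nonneg gF b e'
    have nXS : 0 ≤ ∑ e', excess q gS c e' := Finset.sum_nonneg fun e' _ => excess_nonneg gS c e'
    have hX := (excess_le_fibBit gO h0 h1 a e).trans (fibBit_le_fibWeight gO h0 h1 a e)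
    have hp := sum_fibBit_mul_fibBit_le gF gS h0 h1 hφ hψ b c e
    set Y := ∑ v, fibBit q gF b (φ e v) * fibBit q gS c (ψ e v)
    set Q := ∑ v, excess q gF b (φ e v) * excess q gS c (ψ e v)
    have hm1 : min (fibWeight q gF b * fibWeight q gS c) Y ≤ fibWeight q gF b * fibWeight q gS c :=
      min_le_left _ _
    have hm2 : min (fibWeight q gF b * fibWeight q gS c) Y ≤ Y := min_le_right _ _
    have hY : 0 ≤ Y := Finset.sum_nonneg fun v _ =>
      mul_nonneg (fibBit_nonneg gF h0 h1 _ _) (fibBit_nonneg gS h0 h1 _ _)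
    have hm0 : 0 ≤ min (fibWeight q gF b * fibWeight q gS c) Y :=
      le_min (mul_nonneg nF nS) hY
    have s1 := mul_le_mul_of_nonneg_right (fibBit_le_add_excess (q := q) gO a e) hm0
    have s2 := mul_le_mul_of_nonneg_left hm1 (by positivity : 0 ≤ 2 * q * fibWeight q gO a)
    have s3 := mul_le_mul_of_nonneg_left (hm2.trans hp) nX
    have s4 : excess q gO a e * Q ≤
        ∑ e, ∑ v, excess q gO a e * (excess q gF b (φ e v) * excess q gS c (ψ e v)) := by
      rw [Finset.mul_sum]
      exact Finset.single_le_sum (f := fun e => ∑ v, excess q gO a e *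
          (excess q gF b (φ e v) * excess q gS c (ψ e v)))
        (fun e' _ => Finset.sum_nonneg fun v _ => mul_nonneg (excess_nonneg gO _ _)
          (mul_nonneg (excess_nonneg gF _ _) (excess_nonneg gS _ _))) (Finset.mem_univ e)
    have s5 := mul_le_mul_of_nonneg_right hX (by positivity :
      0 ≤ 4 * q ^ 2 * Fintype.card R * (fibWeight q gF b * fibWeight q gS c)
        + 2 * q * (fibWeight q gF b * ∑ e', excess q gS c e')
        + 2 * q * ((∑ e', excess q gF b e') * fibWeight q gS c))
    linarith
  · simp only [Finset.sum_add_distrib]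
    rw [sum_sum_sum_mul_excess]
    simp only [← Finset.mul_sum, ← Finset.sum_mul, sum_fibWeight]
    set A : E → ℝ := fun e => ∑ a, excess q gO a e with hA
    set B : E → ℝ := fun e => ∑ a, excess q gF a e with hB
    set C : E → ℝ := fun e => ∑ a, excess q gS a e with hC
    have key : ∑ e, ∑ v, A e * (B (φ e v) * C (ψ e v)) ≤ κ := by
      have sq : ∀ {D : E → ℝ}, (∀ e, 0 ≤ D e) → (∀ e, D e ≤ q) → ∑ e, D e ≤ l →
          ∑ e, D e ^ 2 ≤ q * l := by
        intro D hD0 hDq hDl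
        refine le_trans (Finset.sum_le_sum (g := fun e => q * D e) fun e _ => ?_) ?_
        · rw [sq]
          exact mul_le_mul_of_nonneg_right (hDq e) (hD0 e)
        · rw [← Finset.mul_sum]
          exact mul_le_mul_of_nonneg_left hDl h0
      have qA := sq (D := A) (fun e => Finset.sum_nonneg fun a _ => excess_nonneg gO a e)
        (sum_excess_le gO h0 h1) (by rw [hA, Finset.sum_comm]; exact lO)
      have qB := sq (D := B) (fun e => Finset.sum_nonneg fun a _ => excess_nonneg gF a e)
        (sum_excess_le gF h0 h1) (by rw [hB, Finset.sum_comm]; exact lF)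
      have qC := sq (D := C) (fun e => Finset.sum_nonneg fun a _ => excess_nonneg gS a e)
        (sum_excess_le gS h0 h1) (by rw [hC, Finset.sum_comm]; exact lS)
      refine abs_le_of_sq_le_sq' ((hCS A B C).trans (le_trans ?_ hl)) hκ |>.2
      have nB : 0 ≤ ∑ e, B e ^ 2 := Finset.sum_nonneg fun e _ => sq_nonneg _
      have nA : 0 ≤ ∑ e, A e ^ 2 := Finset.sum_nonneg fun e _ => sq_nonneg _
      have nC : 0 ≤ ∑ e, C e ^ 2 := Finset.sum_nonneg fun e _ => sq_nonneg _
      have hql : 0 ≤ q * l := nA.trans qA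
      calc _ ≤ (q * l) * (q * l) * (q * l) := by gcongr
        _ = (q * l) ^ 3 := by ring
    simp only [hA, hB, hC, ← Finset.mul_sum] at key
    have t1 := mul_le_mul_of_nonneg_left lS (by positivity : 0 ≤ 2 * q)
    have t2 := mul_le_mul_of_nonneg_left lF (by positivity : 0 ≤ 2 * q)
    linarith

/-- The success probability, for an edge of the class `O`, of a protocol in which the message about
this class is arbitrarily long. -/
lemma hitProb_le_oneWay [Nonempty MF] [Nonempty MS] (h0 : 0 ≤ q) (h1 : q ≤ 1)
    (hφ : ∀ e, Function.Injective (φ e)) (hψ : ∀ e, Function.Injective (ψ e))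
    (hφψ : Function.Injective fun p : E × R => (φ p.1 p.2, ψ p.1 p.2))
    {l : ℝ} (hF : Real.log (Fintype.card MF) ≤ l) (hS : Real.log (Fintype.card MS) ≤ l) :
    hitProb q φ ψ o gO gF gS ≤ 4 * q ^ 2 * Fintype.card R + 4 * q * l + q * l ^ 2 := by
  have lF := (sum_sum_excess_le gF h0 h1).trans hF
  have lS := (sum_sum_excess_le gS h0 h1).trans hS
  refine (hitProb_le_sum o gO gF gS h0 h1 (fun a b c =>
    4 * q ^ 2 * Fintype.card R * (fibWeight q gO a * fibWeight q gF b * fibWeight q gS c)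
    + 2 * q * (fibWeight q gO a * fibWeight q gF b * ∑ e', excess q gS c e')
    + 2 * q * (fibWeight q gO a * (∑ e', excess q gF b e') * fibWeight q gS c)
    + ∑ e, ∑ v, fibBit q gO a e * (excess q gF b (φ e v) * excess q gS c (ψ e v))) ?_).trans ?_
  · intro a b c
    set e := o a b c
    have nF := fibWeight_nonneg gF h0 h1 b
    have nS := fibWeight_nonneg gS h0 h1 c
    have nX := fibBit_nonneg gO h0 h1 a e
    have nXF : 0 ≤ ∑ e', excess q gF b e' := Finset.sum_nonneg fun e' _ => excess_nonneg gF b e'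
    have nXS : 0 ≤ ∑ e', excess q gS c e' := Finset.sum_nonneg fun e' _ => excess_nonneg gS c e'
    have hX := fibBit_le_fibWeight gO h0 h1 a e
    have hp := sum_fibBit_mul_fibBit_le gF gS h0 h1 hφ hψ b c e
    set Q := ∑ v, excess q gF b (φ e v) * excess q gS c (ψ e v)
    have s3 := mul_le_mul_of_nonneg_left ((min_le_right (fibWeight q gF b * fibWeight q gS c)
      _).trans hp) nX
    have s4 : fibBit q gO a e * Q ≤
        ∑ e, ∑ v, fibBit q gO a e * (excess q gF b (φ e v) * excess q gS c (ψ e v)) := by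
      rw [Finset.mul_sum]
      exact Finset.single_le_sum (f := fun e => ∑ v, fibBit q gO a e *
          (excess q gF b (φ e v) * excess q gS c (ψ e v)))
        (fun e' _ => Finset.sum_nonneg fun v _ => mul_nonneg (fibBit_nonneg gO h0 h1 _ _)
          (mul_nonneg (excess_nonneg gF _ _) (excess_nonneg gS _ _))) (Finset.mem_univ e)
    have s5 := mul_le_mul_of_nonneg_right hX (by positivity :
      0 ≤ 4 * q ^ 2 * Fintype.card R * (fibWeight q gF b * fibWeight q gS c)
        + 2 * q * (fibWeight q gF b * ∑ e', excess q gS c e')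
        + 2 * q * ((∑ e', excess q gF b e') * fibWeight q gS c))
    linarith
  · simp only [Finset.sum_add_distrib]
    rw [sum_sum_sum_mul_excess]
    simp only [← Finset.mul_sum, ← Finset.sum_mul, sum_fibWeight, sum_fibBit]
    set B : E → ℝ := fun e => ∑ a, excess q gF a e with hB
    set C : E → ℝ := fun e => ∑ a, excess q gS a e with hC
    have nB : ∀ e, 0 ≤ B e := fun e => Finset.sum_nonneg fun a _ => excess_nonneg gF a e
    have nC : ∀ e, 0 ≤ C e := fun e => Finset.sum_nonneg fun a _ => excess_nonneg gS a e
    have sB : ∑ e, B e ≤ l := by rw [hB, Finset.sum_comm]; exact lF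
    have sC : ∑ e, C e ≤ l := by rw [hC, Finset.sum_comm]; exact lS
    have hl : 0 ≤ l := (Finset.sum_nonneg fun e _ => nB e).trans sB
    have key : ∑ e, ∑ v, B (φ e v) * C (ψ e v) ≤ l ^ 2 := by
      classical
      rw [← Fintype.sum_prod_type' (f := fun e v => B (φ e v) * C (ψ e v)),
        ← Finset.sum_image (s := Finset.univ) (f := fun p : E × E => B p.1 * C p.2)
          (g := fun p : E × R => (φ p.1 p.2, ψ p.1 p.2)) fun x _ y _ h => hφψ h]
      refine (Finset.sum_le_sum_of_subset_of_nonneg (Finset.subset_univ _) fun p _ _ =>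
        mul_nonneg (nB _) (nC _)).trans ?_
      rw [Fintype.sum_prod_type, ← Fintype.sum_mul_sum, sq]
      exact mul_le_mul sB sC (Finset.sum_nonneg fun e _ => nC e) hl
    have t1 := mul_le_mul_of_nonneg_left lS (by positivity : 0 ≤ 2 * q)
    have t2 := mul_le_mul_of_nonneg_left lF (by positivity : 0 ≤ 2 * q)
    have t3 := mul_le_mul_of_nonneg_left key h0
    linarith

/-- The expected overshoot of the degree beyond twice its mean is at most one, because the variance
of the degree is at most its mean. -/
lemma sum_bernWeight_mul_degree_overshoot_le (h0 : 0 < q) (h1 : q ≤ 1) [Nonempty R] {f : R → E}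
    (hf : Function.Injective f) :
    ∑ x : E → Bool, bernWeight q x *
      max (∑ v, ind (x (f v)) - 2 * q * Fintype.card R) 0 ≤ 1 := by
  classical
  set r : ℝ := (Fintype.card R : ℝ) with hr
  have hr0 : 0 < r := by rw [hr]; exact_mod_cast Fintype.card_pos
  have hρ : 0 < q * r := mul_pos h0 hr0
  have step : ∀ x : E → Bool, max (∑ v, ind (x (f v)) - 2 * q * r) 0
      ≤ (∑ v, ∑ v', ind (x (f v)) * ind (x (f v')) - 2 * (q * r) * ∑ v, ind (x (f v))
        + (q * r) ^ 2) / (q * r) := fun x => by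
    rw [← Finset.sum_mul_sum]
    set d := ∑ v, ind (x (f v))
    have : d * d - 2 * (q * r) * d + (q * r) ^ 2 = (d - q * r) ^ 2 := by ring
    rw [this, le_div_iff₀ hρ]
    rcases le_total (d - 2 * q * r) 0 with h | h
    · rw [max_eq_right h, zero_mul]; positivity
    · rw [max_eq_left h]; nlinarith
  refine (Finset.sum_le_sum fun x _ => mul_le_mul_of_nonneg_left (step x)
    (bernWeight_nonneg h0.le h1 x)).trans ?_
  simp only [mul_div_assoc']
  rw [← Finset.sum_div, div_le_one hρ]
  simp only [mul_add, mul_sub, Finset.sum_add_distrib, Finset.sum_sub_distrib]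
  have e1 : ∑ x : E → Bool, bernWeight q x * ∑ v, ∑ v', ind (x (f v)) * ind (x (f v'))
      = ∑ v : R, ∑ v' : R, if v = v' then q else q ^ 2 := by
    simp only [Finset.mul_sum]
    rw [Finset.sum_comm]
    refine Finset.sum_congr rfl fun v _ => ?_
    rw [Finset.sum_comm]
    refine Finset.sum_congr rfl fun v' _ => ?_
    rw [sum_bernWeight_mul_ind_mul_ind]
    simp [hf.eq_iff]
  have e1' : ∑ v : R, ∑ v' : R, (if v = v' then q else q ^ 2)
      = r * (q - q ^ 2) + r * r * q ^ 2 := by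
    have : ∀ v v' : R, (if v = v' then q else q ^ 2)
        = (if v = v' then q - q ^ 2 else 0) + q ^ 2 := by
      intro v v'; split_ifs <;> ring
    simp only [this, Finset.sum_add_distrib, Finset.sum_ite_eq, Finset.mem_univ, if_true,
      Finset.sum_const, Finset.card_univ, nsmul_eq_mul, ← hr]
    ring
  have e2 : ∑ x : E → Bool, bernWeight q x * (2 * (q * r) * ∑ v, ind (x (f v)))
      = 2 * (q * r) * (r * q) := by
    simp only [mul_left_comm _ (2 * (q * r)), ← Finset.mul_sum]
    congr 1
    simp only [Finset.mul_sum]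
    rw [Finset.sum_comm]
    simp [sum_bernWeight_mul_ind, hr]
  rw [e1, e1', e2, ← Finset.sum_mul, sum_bernWeight]
  nlinarith [mul_pos hr0 (pow_pos h0 2)]

/-- The success probability, for an edge of the class `O`, of a protocol in which the message about
the class `S` is arbitrarily long. -/
lemma hitProb_le_oneWay_side [Nonempty MO] [Nonempty MF] [Nonempty R] (h0 : 0 < q) (h1 : q ≤ 1)
    (hψ : ∀ e, Function.Injective (ψ e)) (hφ : ∀ e, Function.Injective (φ e))
    {l : ℝ} (hO : Real.log (Fintype.card MO) ≤ l) (hF : Real.log (Fintype.card MF) ≤ l) :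
    hitProb q φ ψ o gO gF gS
      ≤ 2 * q + 4 * q ^ 2 * Fintype.card R + 2 * q * l + q * l ^ 2 := by
  have lO := (sum_sum_excess_le gO h0.le h1).trans hO
  have lF := (sum_sum_excess_le gF h0.le h1).trans hF
  set r : ℝ := (Fintype.card R : ℝ) with hr
  set D : MS → E → ℝ := fun c e => ∑ z, if gS z = c then bernWeight q z *
      max (∑ v, ind (z (ψ e v)) - 2 * q * r) 0 else 0 with hD
  have hD0 : ∀ c e, 0 ≤ D c e := fun c e => Finset.sum_nonneg fun z _ => by
    split_ifs
    · exact mul_nonneg (bernWeight_nonneg h0.le h1 z) (le_max_right _ _)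
    · exact le_rfl
  have sD : ∀ e, ∑ c, D c e ≤ 1 := fun e => by
    rw [hD, Finset.sum_comm]
    simpa using sum_bernWeight_mul_degree_overshoot_le h0 h1 (hψ e)
  have hdeg : ∀ c e, ∑ v, fibBit q gS c (ψ e v) ≤ 2 * q * r * fibWeight q gS c + D c e := by
    intro c e
    unfold fibBit fibWeight
    rw [Finset.sum_comm, Finset.mul_sum, hD, ← Finset.sum_add_distrib]
    refine Finset.sum_le_sum fun z _ => ?_
    split_ifs
    · rw [← Finset.mul_sum]
      have := le_max_left (∑ v, ind (z (ψ e v)) - 2 * q * r) 0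
      nlinarith [bernWeight_nonneg h0.le h1 z]
    · simp
  refine (hitProb_le_sum o gO gF gS h0.le h1 (fun a b c =>
    2 * q * (fibWeight q gO a * fibWeight q gF b * fibWeight q gS c)
    + 4 * q ^ 2 * r * (fibWeight q gO a * fibWeight q gF b * fibWeight q gS c)
    + 2 * q * (fibWeight q gF b * ∑ e, excess q gO a e * D c e)
    + ∑ e, ∑ v, excess q gO a e * (excess q gF b (φ e v) * fibBit q gS c (ψ e v))) ?_).trans ?_
  · intro a b c
    set e := o a b c
    have nF := fibWeight_nonneg gF h0.le h1 b
    have nS := fibWeight_nonneg gS h0.le h1 c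
    have nO := fibWeight_nonneg gO h0.le h1 a
    have nX := excess_nonneg (q := q) gO a e
    have hX := (excess_le_fibBit gO h0.le h1 a e).trans (fibBit_le_fibWeight gO h0.le h1 a e)
    set Y := ∑ v, fibBit q gF b (φ e v) * fibBit q gS c (ψ e v) with hYdef
    set Q := ∑ v, excess q gF b (φ e v) * fibBit q gS c (ψ e v) with hQ
    have hm2 : min (fibWeight q gF b * fibWeight q gS c) Y ≤ Y := min_le_right _ _
    have hY : 0 ≤ Y := Finset.sum_nonneg fun v _ =>
      mul_nonneg (fibBit_nonneg gF h0.le h1 _ _) (fibBit_nonneg gS h0.le h1 _ _)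
    have hm0 : 0 ≤ min (fibWeight q gF b * fibWeight q gS c) Y :=
      le_min (mul_nonneg nF nS) hY
    have hp : Y ≤ 2 * q * fibWeight q gF b * (2 * q * r * fibWeight q gS c + D c e) + Q := by
      refine le_trans ?_ (add_le_add_left (mul_le_mul_of_nonneg_left (hdeg c e)
        (by positivity : 0 ≤ 2 * q * fibWeight q gF b)) Q)
      rw [hYdef, hQ, Finset.mul_sum, ← Finset.sum_add_distrib]
      refine Finset.sum_le_sum fun v _ => ?_
      have := mul_le_mul_of_nonneg_right (fibBit_le_add_excess (q := q) gF b (φ e v))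
        (fibBit_nonneg gS h0.le h1 c (ψ e v))
      linarith
    have s1 := mul_le_mul_of_nonneg_right (fibBit_le_add_excess (q := q) gO a e) hm0
    have s2 := mul_le_mul_of_nonneg_left (min_le_left (fibWeight q gF b * fibWeight q gS c) Y)
      (by positivity : 0 ≤ 2 * q * fibWeight q gO a)
    have s3 := mul_le_mul_of_nonneg_left (hm2.trans hp) nX
    have s4 : excess q gO a e * Q ≤
        ∑ e, ∑ v, excess q gO a e * (excess q gF b (φ e v) * fibBit q gS c (ψ e v)) := by
      rw [hQ, Finset.mul_sum]
      exact Finset.single_le_sum (f := fun e => ∑ v, excess q gO a e *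
          (excess q gF b (φ e v) * fibBit q gS c (ψ e v)))
        (fun e' _ => Finset.sum_nonneg fun v _ => mul_nonneg (excess_nonneg gO _ _)
          (mul_nonneg (excess_nonneg gF _ _) (fibBit_nonneg gS h0.le h1 _ _))) (Finset.mem_univ e)
    have s5 := mul_le_mul_of_nonneg_right hX (by positivity :
      0 ≤ 4 * q ^ 2 * r * (fibWeight q gF b * fibWeight q gS c))
    have s6 := mul_le_mul_of_nonneg_left (Finset.single_le_sum (f := fun e =>
      excess q gO a e * D c e) (fun e' _ => mul_nonneg (excess_nonneg gO _ _) (hD0 _ _))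
        (Finset.mem_univ e)) (by positivity : 0 ≤ 2 * q * fibWeight q gF b)
    linarith
  · simp only [Finset.sum_add_distrib]
    rw [sum_sum_sum_mul_excess]
    simp only [← Finset.mul_sum, ← Finset.sum_mul, sum_fibWeight, sum_fibBit]
    set A : E → ℝ := fun e => ∑ a, excess q gO a e with hA
    set B : E → ℝ := fun e => ∑ a, excess q gF a e with hB
    have nA : ∀ e, 0 ≤ A e := fun e => Finset.sum_nonneg fun a _ => excess_nonneg gO a e
    have nB : ∀ e, 0 ≤ B e := fun e => Finset.sum_nonneg fun a _ => excess_nonneg gF a e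
    have sA : ∑ e, A e ≤ l := by rw [hA, Finset.sum_comm]; exact lO
    have sB : ∑ e, B e ≤ l := by rw [hB, Finset.sum_comm]; exact lF
    have hl : 0 ≤ l := (Finset.sum_nonneg fun e _ => nB e).trans sB
    have key : ∑ e, ∑ v, A e * (B (φ e v) * q) ≤ q * l ^ 2 := by
      have : ∀ e, ∑ v, A e * (B (φ e v) * q) ≤ A e * (l * q) := fun e => by
        rw [← Finset.mul_sum, ← Finset.sum_mul]
        exact mul_le_mul_of_nonneg_left (mul_le_mul_of_nonneg_right
          ((sum_comp_le_of_injective (hφ e) nB).trans sB) h0.le) (nA e)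
      refine (Finset.sum_le_sum fun e _ => this e).trans ?_
      rw [← Finset.sum_mul]
      nlinarith [mul_le_mul_of_nonneg_right sA (by positivity : 0 ≤ l * q)]
    have key2 : ∑ a, ∑ c, ∑ e, excess q gO a e * D c e ≤ l := by
      have : ∑ a, ∑ c, ∑ e, excess q gO a e * D c e = ∑ e, A e * ∑ c, D c e := by
        simp only [hA, Finset.sum_mul_sum]
        symm
        rw [Finset.sum_comm]
        refine Finset.sum_congr rfl fun a _ => Finset.sum_comm
      rw [this]
      refine le_trans (Finset.sum_le_sum fun e _ => ?_) sA
      exact mul_le_of_le_one_right (nA e) (sD e)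
    simp only [hA, hB, ← Finset.mul_sum, ← Finset.sum_mul] at key
    have t1 := mul_le_mul_of_nonneg_left key2 (by positivity : 0 ≤ 2 * q)
    linarith

end Bounds

/-! ### Triangles in the random graph -/

section Triple

variable {E : Type*} [Fintype E] [DecidableEq E]

/-- The probability of three independent families of random bits. -/
noncomputable def tripleWeight (q : ℝ) (z : (E → Bool) × (E → Bool) × (E → Bool)) : ℝ :=
  bernWeight q z.1 * (bernWeight q z.2.1 * bernWeight q z.2.2)

lemma tripleWeight_nonneg {q : ℝ} (h0 : 0 ≤ q) (h1 : q ≤ 1)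
    (z : (E → Bool) × (E → Bool) × (E → Bool)) : 0 ≤ tripleWeight q z :=
  mul_nonneg (bernWeight_nonneg h0 h1 _)
    (mul_nonneg (bernWeight_nonneg h0 h1 _) (bernWeight_nonneg h0 h1 _))

lemma sum_tripleWeight_mul (q : ℝ) (f g h : (E → Bool) → ℝ) :
    ∑ z, tripleWeight q z * (f z.1 * g z.2.1 * h z.2.2)
      = (∑ x, bernWeight q x * f x) * (∑ x, bernWeight q x * g x) * ∑ x, bernWeight q x * h x := by
  rw [← sum_sum_sum_mul]
  simp only [Fintype.sum_prod_type, tripleWeight]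
  exact Finset.sum_congr rfl fun x _ => Finset.sum_congr rfl fun y _ =>
    Finset.sum_congr rfl fun z _ => by ring

lemma sum_tripleWeight (q : ℝ) :
    ∑ z : (E → Bool) × (E → Bool) × (E → Bool), tripleWeight q z = 1 := by
  simpa [sum_bernWeight] using sum_tripleWeight_mul (E := E) q (fun _ => 1) (fun _ => 1) fun _ => 1

end Triple

section Triangles

variable {I R : Type*} [Fintype I] [DecidableEq I] [Fintype R] [DecidableEq R]

/-- The triangle with vertices `a, b, c` in the block `i` is present in `z`. -/
def present (z : (I × R × R → Bool) × (I × R × R → Bool) × (I × R × R → Bool))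
    (τ : I × R × R × R) : Bool :=
  z.1 (τ.1, τ.2.1, τ.2.2.1) && z.2.1 (τ.1, τ.2.2.1, τ.2.2.2) && z.2.2 (τ.1, τ.2.2.2, τ.2.1)

/-- Two different triangles share an edge. -/
def Shares (τ τ' : I × R × R × R) : Prop :=
  τ ≠ τ' ∧ ((τ.1, τ.2.1, τ.2.2.1) = (τ'.1, τ'.2.1, τ'.2.2.1) ∨
    (τ.1, τ.2.2.1, τ.2.2.2) = (τ'.1, τ'.2.2.1, τ'.2.2.2) ∨
    (τ.1, τ.2.2.2, τ.2.1) = (τ'.1, τ'.2.2.2, τ'.2.1))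

instance : DecidableRel (Shares (I := I) (R := R)) := fun _ _ =>
  inferInstanceAs (Decidable (_ ∧ _))

/-- The present triangles that share no edge with another present triangle. -/
def isolatedTriangles (z : (I × R × R → Bool) × (I × R × R → Bool) × (I × R × R → Bool)) :
    Finset (I × R × R × R) :=
  Finset.univ.filter fun τ => present z τ = true ∧ ∀ τ', present z τ' = true → ¬ Shares τ τ'

lemma ind_present (z : (I × R × R → Bool) × (I × R × R → Bool) × (I × R × R → Bool))
    (τ : I × R × R × R) :
    ind (present z τ) = ind (z.1 (τ.1, τ.2.1, τ.2.2.1)) * ind (z.2.1 (τ.1, τ.2.2.1, τ.2.2.2)) *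
      ind (z.2.2 (τ.1, τ.2.2.2, τ.2.1)) := by
  unfold present
  cases z.1 (τ.1, τ.2.1, τ.2.2.1) <;> cases z.2.1 (τ.1, τ.2.2.1, τ.2.2.2) <;>
    cases z.2.2 (τ.1, τ.2.2.2, τ.2.1) <;> simp [ind]

lemma sum_tripleWeight_mul_present (q : ℝ) (τ : I × R × R × R) :
    ∑ z, tripleWeight q z * ind (present z τ) = q ^ 3 := by
  simp only [ind_present]
  rw [sum_tripleWeight_mul q (fun x => ind (x (τ.1, τ.2.1, τ.2.2.1)))
    (fun x => ind (x (τ.1, τ.2.2.1, τ.2.2.2))) (fun x => ind (x (τ.1, τ.2.2.2, τ.2.1)))]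
  simp only [sum_bernWeight_mul_ind]
  ring

lemma sum_tripleWeight_mul_present_mul_present (q : ℝ) (τ τ' : I × R × R × R) :
    ∑ z, tripleWeight q z * (ind (present z τ) * ind (present z τ'))
      = if τ = τ' then q ^ 3 else if Shares τ τ' then q ^ 5 else q ^ 6 := by
  have h := sum_tripleWeight_mul q
    (fun x => ind (x (τ.1, τ.2.1, τ.2.2.1)) * ind (x (τ'.1, τ'.2.1, τ'.2.2.1)))
    (fun x => ind (x (τ.1, τ.2.2.1, τ.2.2.2)) * ind (x (τ'.1, τ'.2.2.1, τ'.2.2.2)))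
    (fun x => ind (x (τ.1, τ.2.2.2, τ.2.1)) * ind (x (τ'.1, τ'.2.2.2, τ'.2.1)))
  simp only [sum_bernWeight_mul_ind_mul_ind] at h
  refine (Finset.sum_congr rfl fun z _ => ?_).trans (h.trans ?_)
  · simp only [ind_present]
    ring
  clear h
  obtain ⟨i, a, b, c⟩ := τ
  obtain ⟨i', a', b', c'⟩ := τ'
  simp only [Shares, Prod.mk.injEq, ne_eq]
  by_cases hi : i = i' <;> by_cases ha : a = a' <;> by_cases hb : b = b' <;>
    by_cases hc : c = c' <;> simp [hi, ha, hb, hc] <;> ring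

lemma card_shares_le (τ : I × R × R × R) :
    (Finset.univ.filter fun τ' => Shares τ τ').card ≤ 3 * Fintype.card R := by
  have hsub : (Finset.univ.filter fun τ' => Shares τ τ') ⊆
      (Finset.univ.image fun v : R => (τ.1, τ.2.1, τ.2.2.1, v)) ∪
      ((Finset.univ.image fun v : R => (τ.1, v, τ.2.2.1, τ.2.2.2)) ∪
      (Finset.univ.image fun v : R => (τ.1, τ.2.1, v, τ.2.2.2))) := by
    rintro ⟨i, a, b, c⟩ h
    simp only [Finset.mem_filter, Finset.mem_univ, true_and, Shares, Prod.mk.injEq] at h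
    simp only [Finset.mem_union, Finset.mem_image, Finset.mem_univ, true_and, Prod.mk.injEq]
    rcases h.2 with h | h | h
    · exact Or.inl ⟨c, h.1, h.2.1, h.2.2, rfl⟩
    · exact Or.inr (Or.inl ⟨a, h.1, rfl, h.2.1, h.2.2⟩)
    · exact Or.inr (Or.inr ⟨b, h.1, h.2.2, rfl, h.2.1⟩)
  refine (Finset.card_le_card hsub).trans ((Finset.card_union_le _ _).trans ?_)
  have hc : ∀ f : R → I × R × R × R, (Finset.univ.image f).card ≤ Fintype.card R := fun f =>
    Finset.card_image_le
  have := Finset.card_union_le (Finset.univ.image fun v : R => (τ.1, v, τ.2.2.1, τ.2.2.2))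
    (Finset.univ.image fun v : R => (τ.1, τ.2.1, v, τ.2.2.2))
  have h1 := hc fun v : R => (τ.1, τ.2.1, τ.2.2.1, v)
  have h2 := hc fun v : R => (τ.1, v, τ.2.2.1, τ.2.2.2)
  have h3 := hc fun v : R => (τ.1, τ.2.1, v, τ.2.2.2)
  omega

/-- The number of ordered pairs of present triangles that share an edge. -/
noncomputable def sharingPairs
    (z : (I × R × R → Bool) × (I × R × R → Bool) × (I × R × R → Bool)) : ℝ :=
  ∑ τ, ∑ τ', if Shares τ τ' then ind (present z τ) * ind (present z τ') else 0

lemma sum_present_le (z : (I × R × R → Bool) × (I × R × R → Bool) × (I × R × R → Bool)) :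
    ∑ τ, ind (present z τ) ≤ (isolatedTriangles z).card + sharingPairs z := by
  rw [isolatedTriangles, Finset.card_filter, sharingPairs]
  push_cast
  rw [← Finset.sum_add_distrib]
  refine Finset.sum_le_sum fun τ _ => ?_
  have hn : ∀ τ', 0 ≤ if Shares τ τ' then ind (present z τ) * ind (present z τ') else 0 :=
    fun τ' => by
      split_ifs
      · exact mul_nonneg (ind_nonneg _) (ind_nonneg _)
      · exact le_rfl
  have hs := Finset.sum_nonneg fun τ' (_ : τ' ∈ Finset.univ) => hn τ'
  split_ifs with h
  · exact (ind_le_one _).trans (by linarith)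
  · cases hp : present z τ
    · simp [ind]
    · have : ∃ τ', present z τ' = true ∧ Shares τ τ' := by
        by_contra hcon
        exact h ⟨hp, fun τ' h1 h2 => hcon ⟨τ', h1, h2⟩⟩
      obtain ⟨τ', h1, h2⟩ := this
      have h3 := Finset.single_le_sum (fun τ' _ => hn τ') (Finset.mem_univ τ')
      simp only [h1, h2, hp, if_true] at h3
      simpa [ind] using h3

lemma sum_tripleWeight_mul_sharingPairs_le {q : ℝ} (h0 : 0 ≤ q) :
    ∑ z : (I × R × R → Bool) × (I × R × R → Bool) × (I × R × R → Bool),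
      tripleWeight q z * sharingPairs z
      ≤ 3 * Fintype.card (I × R × R × R) * Fintype.card R * q ^ 5 := by
  simp only [sharingPairs, Finset.mul_sum]
  rw [Finset.sum_comm]
  have : ∀ τ : I × R × R × R, (∑ z, ∑ τ', tripleWeight q z *
      if Shares τ τ' then ind (present z τ) * ind (present z τ') else 0)
      ≤ 3 * Fintype.card R * q ^ 5 := by
    intro τ
    rw [Finset.sum_comm]
    have h : ∀ τ', (∑ z, tripleWeight q z *
        if Shares τ τ' then ind (present z τ) * ind (present z τ') else 0)
        = if Shares τ τ' then q ^ 5 else 0 := fun τ' => by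
      split_ifs with hs
      · rw [sum_tripleWeight_mul_present_mul_present, if_neg hs.1, if_pos hs]
      · simp
    simp only [h]
    rw [← Finset.sum_filter, Finset.sum_const, nsmul_eq_mul]
    exact mul_le_mul_of_nonneg_right (by exact_mod_cast card_shares_le τ) (by positivity)
  refine (Finset.sum_le_sum fun τ _ => this τ).trans (le_of_eq ?_)
  rw [Finset.sum_const, Finset.card_univ, nsmul_eq_mul]
  ring

lemma variance_present_le {q : ℝ} (h0 : 0 ≤ q) :
    ∑ z : (I × R × R → Bool) × (I × R × R → Bool) × (I × R × R → Bool),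
      tripleWeight q z * (∑ τ, ind (present z τ) - Fintype.card (I × R × R × R) * q ^ 3) ^ 2
      ≤ Fintype.card (I × R × R × R) * q ^ 3
        + 3 * Fintype.card (I × R × R × R) * Fintype.card R * q ^ 5 := by
  set n : ℝ := (Fintype.card (I × R × R × R) : ℝ) with hn
  have e1 : ∀ z : (I × R × R → Bool) × (I × R × R → Bool) × (I × R × R → Bool),
      tripleWeight q z * (∑ τ, ind (present z τ) - n * q ^ 3) ^ 2
      = ∑ τ, ∑ τ', tripleWeight q z * (ind (present z τ) * ind (present z τ'))
        - 2 * (n * q ^ 3) * ∑ τ, tripleWeight q z * ind (present z τ)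
        + tripleWeight q z * (n * q ^ 3) ^ 2 := fun z => by
    simp only [← Finset.mul_sum, ← Finset.sum_mul]
    ring
  simp only [e1, Finset.sum_add_distrib, Finset.sum_sub_distrib]
  rw [← Finset.mul_sum, ← Finset.sum_mul, sum_tripleWeight, Finset.sum_comm, Finset.sum_comm]
  have e2 : ∑ z, ∑ τ : I × R × R × R, tripleWeight q z * ind (present z τ) = n * q ^ 3 := by
    rw [Finset.sum_comm]
    simp only [sum_tripleWeight_mul_present, Finset.sum_const, Finset.card_univ, nsmul_eq_mul, hn]
  rw [e2, Finset.sum_comm]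
  have e3 : ∀ τ : I × R × R × R, (∑ z, ∑ τ', tripleWeight q z *
      (ind (present z τ) * ind (present z τ'))) ≤ q ^ 3 + 3 * Fintype.card R * q ^ 5
        + n * q ^ 6 := fun τ => by
    rw [Finset.sum_comm]
    simp only [sum_tripleWeight_mul_present_mul_present]
    have : ∀ τ' : I × R × R × R, (if τ = τ' then q ^ 3 else if Shares τ τ' then q ^ 5 else q ^ 6)
        ≤ (if τ = τ' then q ^ 3 else 0) + (if Shares τ τ' then q ^ 5 else 0) + q ^ 6 := fun τ' => by
      have h3 := pow_nonneg h0 3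
      have h5 := pow_nonneg h0 5
      have h6 := pow_nonneg h0 6
      split_ifs <;> linarith
    refine (Finset.sum_le_sum fun τ' _ => this τ').trans ?_
    rw [Finset.sum_add_distrib, Finset.sum_add_distrib, Finset.sum_ite_eq,
      if_pos (Finset.mem_univ _),
      ← Finset.sum_filter, Finset.sum_const, Finset.sum_const, nsmul_eq_mul, nsmul_eq_mul,
      Finset.card_univ, ← hn]
    have := mul_le_mul_of_nonneg_right (by exact_mod_cast card_shares_le τ :
      ((Finset.univ.filter fun τ' => Shares τ τ').card : ℝ) ≤ 3 * Fintype.card R)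
      (pow_nonneg h0 5)
    linarith
  have e4 := Finset.sum_le_sum fun τ (_ : τ ∈ Finset.univ) => e3 τ
  rw [Finset.sum_const, Finset.card_univ, nsmul_eq_mul, ← hn] at e4
  nlinarith

/-- With the edge probability `q` for which the expected number of triangles at an edge is
`|R| q ^ 2 = 1 / 100`, the random graph has, with probability at least `0.6`, few edges in each
class and many edge-disjoint triangles. -/
lemma prob_valid_ge {q : ℝ} (h0 : 0 ≤ q) (h1 : q ≤ 1) (hq : Fintype.card R * q ^ 2 = 1 / 100)
    (hn : 1000 ≤ Fintype.card (I × R × R × R) * q ^ 3)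
    (μ : ℕ) (hμ : 12 * (Fintype.card (I × R × R) * q) ≤ μ) :
    6 / 10 ≤ ∑ z : (I × R × R → Bool) × (I × R × R → Bool) × (I × R × R → Bool),
      tripleWeight q z * if ((Finset.univ.filter fun e => z.1 e = true).card ≤ μ ∧
        (Finset.univ.filter fun e => z.2.1 e = true).card ≤ μ ∧
        (Finset.univ.filter fun e => z.2.2 e = true).card ≤ μ ∧
        Fintype.card (I × R × R × R) * q ^ 3 / 4 ≤ (isolatedTriangles z).card)
        then 1 else 0 := by
  set t : ℝ := Fintype.card (I × R × R × R) * q ^ 3 with ht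
  have ht0 : 0 < t := by linarith
  have hE : 0 < Fintype.card (I × R × R) * q := by
    rcases (mul_nonneg (Nat.cast_nonneg (Fintype.card (I × R × R))) h0 : (0 : ℝ) ≤ _).lt_or_eq
      with h | h
    · exact h
    · exfalso
      have : t = (Fintype.card (I × R × R) * q) * (Fintype.card R * q ^ 2) := by
        rw [ht]; simp only [Fintype.card_prod]; push_cast; ring
      rw [this, ← h] at ht0
      simp at ht0
  have hμ0 : (0 : ℝ) < μ := by linarith
  have hcount : ∀ x : I × R × R → Bool,
      ((Finset.univ.filter fun e => x e = true).card : ℝ) = ∑ e, ind (x e) := fun x => by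
    rw [Finset.card_filter]; push_cast; rfl
  have hmean : ∑ x : I × R × R → Bool, bernWeight q x *
      ((Finset.univ.filter fun e => x e = true).card : ℝ) = Fintype.card (I × R × R) * q := by
    simp only [hcount, Finset.mul_sum]
    rw [Finset.sum_comm]
    simp [sum_bernWeight_mul_ind]
  -- the indicator of the complement is bounded by four nonnegative terms with small expectation
  have key : ∀ z : (I × R × R → Bool) × (I × R × R → Bool) × (I × R × R → Bool),
      1 - ((((Finset.univ.filter fun e => z.1 e = true).card : ℝ) * 1 * 1 +
        1 * ((Finset.univ.filter fun e => z.2.1 e = true).card : ℝ) * 1 +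
        1 * 1 * ((Finset.univ.filter fun e => z.2.2 e = true).card : ℝ)) / μ
        + 4 / t ^ 2 * (∑ τ, ind (present z τ) - t) ^ 2 + 4 / t * sharingPairs z)
      ≤ if ((Finset.univ.filter fun e => z.1 e = true).card ≤ μ ∧
        (Finset.univ.filter fun e => z.2.1 e = true).card ≤ μ ∧
        (Finset.univ.filter fun e => z.2.2 e = true).card ≤ μ ∧
        t / 4 ≤ (isolatedTriangles z).card) then 1 else 0 := by
    intro z
    have hsp : 0 ≤ sharingPairs z := Finset.sum_nonneg fun τ _ => Finset.sum_nonneg fun τ' _ => by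
      split_ifs
      · exact mul_nonneg (ind_nonneg _) (ind_nonneg _)
      · exact le_rfl
    have hle := sum_present_le z
    generalize (Finset.univ.filter fun e => z.1 e = true).card = A
    generalize (Finset.univ.filter fun e => z.2.1 e = true).card = B
    generalize (Finset.univ.filter fun e => z.2.2 e = true).card = C
    set T := ∑ τ, ind (present z τ)
    have p1 : (0 : ℝ) ≤ (A * 1 * 1 + 1 * B * 1 + 1 * 1 * C) / μ := by positivity
    have p2 : 0 ≤ 4 / t ^ 2 * (T - t) ^ 2 := by positivity
    have p3 : 0 ≤ 4 / t * sharingPairs z := by positivity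
    split_ifs with h
    · linarith
    · have hbad : μ < A ∨ μ < B ∨ μ < C ∨ ((isolatedTriangles z).card : ℝ) < t / 4 := by
        by_contra hcon
        push Not at hcon
        exact h hcon
      have big : ∀ {D : ℕ}, μ < D → (D : ℝ) ≤ A + B + C →
          (1 : ℝ) ≤ (A * 1 * 1 + 1 * B * 1 + 1 * 1 * C) / μ := by
        intro D hD hD'
        rw [le_div_iff₀ hμ0]
        have : (μ : ℝ) < D := by exact_mod_cast hD
        linarith
      have hA : (0 : ℝ) ≤ A := Nat.cast_nonneg A
      have hB : (0 : ℝ) ≤ B := Nat.cast_nonneg B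
      have hC : (0 : ℝ) ≤ C := Nat.cast_nonneg C
      rcases hbad with hb | hb | hb | hb
      · linarith [big hb (by linarith)]
      · linarith [big hb (by linarith)]
      · linarith [big hb (by linarith)]
      · rcases le_or_gt (t / 4) (sharingPairs z) with hs | hs
        · have : 1 ≤ 4 / t * sharingPairs z := by
            rw [div_mul_eq_mul_div, le_div_iff₀ ht0]; linarith
          linarith
        · have hT : T < t / 2 := by linarith
          have : 1 ≤ 4 / t ^ 2 * (T - t) ^ 2 := by
            rw [div_mul_eq_mul_div, le_div_iff₀ (by positivity)]
            nlinarith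
          linarith
  refine le_trans ?_ (Finset.sum_le_sum fun z _ => mul_le_mul_of_nonneg_left (key z)
    (tripleWeight_nonneg h0 h1 z))
  have q1 := sum_tripleWeight_mul q (fun x : I × R × R → Bool =>
    ((Finset.univ.filter fun e => x e = true).card : ℝ)) (fun _ => 1) (fun _ => 1)
  have q2 := sum_tripleWeight_mul q (fun _ => 1) (fun x : I × R × R → Bool =>
    ((Finset.univ.filter fun e => x e = true).card : ℝ)) (fun _ => 1)
  have q3 := sum_tripleWeight_mul q (fun _ => 1) (fun _ => 1) (fun x : I × R × R → Bool =>
    ((Finset.univ.filter fun e => x e = true).card : ℝ))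
  simp only [mul_one, sum_bernWeight, hmean, one_mul] at q1 q2 q3
  have q4 := variance_present_le (I := I) (R := R) h0
  have q5 := sum_tripleWeight_mul_sharingPairs_le (I := I) (R := R) h0
  rw [← ht] at q4
  have e5 : 3 * (Fintype.card (I × R × R × R) : ℝ) * Fintype.card R * q ^ 5 = 3 / 100 * t := by
    have : 3 * (Fintype.card (I × R × R × R) : ℝ) * Fintype.card R * q ^ 5
      = 3 * t * (Fintype.card R * q ^ 2) := by rw [ht]; ring
    rw [this, hq]; ring
  rw [e5] at q4 q5
  have expand : ∀ z : (I × R × R → Bool) × (I × R × R → Bool) × (I × R × R → Bool),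
      tripleWeight q z * (1 - ((((Finset.univ.filter fun e => z.1 e = true).card : ℝ) * 1 * 1 +
        1 * ((Finset.univ.filter fun e => z.2.1 e = true).card : ℝ) * 1 +
        1 * 1 * ((Finset.univ.filter fun e => z.2.2 e = true).card : ℝ)) / μ
        + 4 / t ^ 2 * (∑ τ, ind (present z τ) - t) ^ 2 + 4 / t * sharingPairs z))
      = tripleWeight q z
        - 1 / μ * (tripleWeight q z * ((Finset.univ.filter fun e => z.1 e = true).card : ℝ))
        - 1 / μ * (tripleWeight q z * ((Finset.univ.filter fun e => z.2.1 e = true).card : ℝ))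
        - 1 / μ * (tripleWeight q z * ((Finset.univ.filter fun e => z.2.2 e = true).card : ℝ))
        - 4 / t ^ 2 * (tripleWeight q z * (∑ τ, ind (present z τ) - t) ^ 2)
        - 4 / t * (tripleWeight q z * sharingPairs z) := fun z => by ring
  simp only [expand, Finset.sum_sub_distrib, ← Finset.mul_sum, q1, q2, q3, sum_tripleWeight]
  have b1 : 1 / (μ : ℝ) * (Fintype.card (I × R × R) * q) ≤ 1 / 12 := by
    rw [one_div_mul_eq_div, div_le_iff₀ hμ0]; linarith
  have b2 := mul_le_mul_of_nonneg_left q4 (by positivity : 0 ≤ 4 / t ^ 2)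
  have b3 := mul_le_mul_of_nonneg_left q5 (by positivity : 0 ≤ 4 / t)
  have b4 : 4 / t ^ 2 * (t + 3 / 100 * t) ≤ 5 / 1000 := by
    rw [div_mul_eq_mul_div, div_le_iff₀ (by positivity)]; nlinarith
  have b5 : 4 / t * (3 / 100 * t) = 12 / 100 := by field_simp; norm_num
  linarith

end Triangles

/-! ### The graph of blocks and the inputs of the players -/

section Blocks

/-- The position in part `t` of the block with base point `i.1` and direction `i.2`, in dimension
one: the term `t` of the progression in `ℤ/3` with first term `i.1` and difference `0` or `1`. -/
def basePos (t : Fin 3) (i : Fin 3 × Bool) : Fin 3 := i.1 + if i.2 then t else 0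

lemma basePos_injective : ∀ (t : Fin 3) (i i' : Fin 3 × Bool), basePos t i = basePos t i' →
    basePos (t + 1) i = basePos (t + 1) i' → i = i' := by decide

lemma basePos_triangle : ∀ (t : Fin 3) (i j k : Fin 3 × Bool),
    basePos (t + 1) i = basePos (t + 1) j →
    basePos (t + 1 + 1) j = basePos (t + 1 + 1) k → basePos t k = basePos t i → i = j ∧ j = k := by
  decide

/-- The index set of the blocks: progressions in `(ℤ/3)^D` with a difference in `{0, 1}^D`. -/
abbrev Block (D : ℕ) := Fin D → Fin 3 × Bool

/-- The potential edges of one class: an edge joins two vertices of a block, each of which is given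
by its index in `Fin r`. -/
abbrev CoreEdge (D r : ℕ) := Block D × Fin r × Fin r

/-- The term `t` of the progression `i`. -/
def pos {D : ℕ} (t : Fin 3) (i : Block D) : Fin D → Fin 3 := fun j => basePos t (i j)

lemma pos_injective {D : ℕ} {t : Fin 3} {i i' : Block D} (h : pos t i = pos t i')
    (h' : pos (t + 1) i = pos (t + 1) i') : i = i' :=
  funext fun j => basePos_injective t _ _ (congrFun h j) (congrFun h' j)

/-- Three edges that form a triangle lie in one block, because `{0, 1}^D` contains no three elements
of sum zero in `(ℤ/3)^D` other than the constant triples. -/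
lemma pos_triangle {D : ℕ} {t : Fin 3} {i j k : Block D} (h : pos (t + 1) i = pos (t + 1) j)
    (h' : pos (t + 1 + 1) j = pos (t + 1 + 1) k) (h'' : pos t k = pos t i) : i = j ∧ j = k :=
  ⟨funext fun l => (basePos_triangle t _ _ _ (congrFun h l) (congrFun h' l) (congrFun h'' l)).1,
    funext fun l => (basePos_triangle t _ _ _ (congrFun h l) (congrFun h' l) (congrFun h'' l)).2⟩

end Blocks

section Graph

/-- The vertices: three parts, each of which consists of `r` copies of `(ℤ/3)^D`, and the vertices
that serve for padding. -/
abbrev Vertex (D r p : ℕ) := (Fin 3 × (Fin D → Fin 3) × Fin r) ⊕ (Fin p ⊕ Fin 3 × Fin p)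

/-- The potential edges of one player: those of its class, and those for padding. -/
abbrev Slot (D r p : ℕ) := CoreEdge D r ⊕ Fin p × Fin p

variable {D r p n : ℕ}

/-- The first endpoint of an edge of class `t`. -/
def tail (t : Fin 3) : Slot D r p → Vertex D r p
  | Sum.inl e => Sum.inl (t, pos t e.1, e.2.1)
  | Sum.inr e => Sum.inr (Sum.inl e.1)

/-- The second endpoint of an edge of class `t`. -/
def head (t : Fin 3) : Slot D r p → Vertex D r p
  | Sum.inl e => Sum.inl (t + 1, pos (t + 1) e.1, e.2.2)
  | Sum.inr e => Sum.inr (Sum.inr (t, e.2))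

lemma fin_three_ne_add_one : ∀ t : Fin 3, t ≠ t + 1 := by decide

lemma fin_three_ne_add_one_add_one : ∀ t : Fin 3, t ≠ t + 1 + 1 := by decide

lemma tail_ne_head (t : Fin 3) (ε : Slot D r p) : tail t ε ≠ head t ε := by
  rcases ε with e | e
  · simp [tail, head, fin_three_ne_add_one t]
  · simp [tail, head]

lemma eq_of_tail_eq_of_head_eq {t t' : Fin 3} {ε ε' : Slot D r p} (h : tail t ε = tail t' ε')
    (h' : head t ε = head t' ε') : t = t' ∧ ε = ε' := by
  rcases ε with ⟨i, u, v⟩ | ⟨a, b⟩ <;> rcases ε' with ⟨i', u', v'⟩ | ⟨a', b'⟩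
  · simp only [tail, head, Sum.inl.injEq, Prod.mk.injEq] at h h'
    obtain ⟨rfl, h1, rfl⟩ := h
    obtain ⟨-, h2, rfl⟩ := h'
    exact ⟨rfl, by rw [pos_injective h1 h2]⟩
  · simp [tail] at h
  · simp [tail] at h
  · simp only [tail, head, Sum.inr.injEq, Sum.inl.injEq, Prod.mk.injEq] at h h'
    exact ⟨h'.1, by rw [h, h'.2]⟩

lemma not_tail_eq_head_and_head_eq_tail {t t' : Fin 3} {ε ε' : Slot D r p}
    (h : tail t ε = head t' ε') (h' : head t ε = tail t' ε') : False := by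
  rcases ε with ⟨i, u, v⟩ | ⟨a, b⟩ <;> rcases ε' with ⟨i', u', v'⟩ | ⟨a', b'⟩
  · simp only [tail, head, Sum.inl.injEq, Prod.mk.injEq] at h h'
    have := h.1
    rw [← h'.1] at this
    exact fin_three_ne_add_one_add_one t this
  all_goals simp [tail, head] at h

/-- The edge of class `t`, when the vertices are placed into `Fin n` by `f`. -/
def edge (f : Vertex D r p ↪ Fin n) (t : Fin 3) (ε : Slot D r p) : Sym2 (Fin n) :=
  s(f (tail t ε), f (head t ε))

lemma edge_inj {f : Vertex D r p ↪ Fin n} {t t' : Fin 3} {ε ε' : Slot D r p}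
    (h : edge f t ε = edge f t' ε') : t = t' ∧ ε = ε' := by
  rcases Sym2.eq_iff.1 h with ⟨h1, h2⟩ | ⟨h1, h2⟩
  · exact eq_of_tail_eq_of_head_eq (f.injective h1) (f.injective h2)
  · exact (not_tail_eq_head_and_head_eq_tail (f.injective h1) (f.injective h2)).elim

/-- The graph with the edges `S` of class `t`. -/
def classGraph (f : Vertex D r p ↪ Fin n) (t : Fin 3) (S : Finset (Slot D r p)) :
    SimpleGraph (Fin n) :=
  SimpleGraph.fromEdgeSet (edge f t '' S)

/-- The union of the graphs of the three classes. -/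
def unionGraph (f : Vertex D r p ↪ Fin n) (S : Fin 3 → Finset (Slot D r p)) :
    SimpleGraph (Fin n) :=
  ⨆ t, classGraph f t (S t)

variable {f : Vertex D r p ↪ Fin n} {S : Fin 3 → Finset (Slot D r p)}

lemma mem_edgeSet_unionGraph {e : Sym2 (Fin n)} :
    e ∈ (unionGraph f S).edgeSet ↔ ∃ t, ∃ ε ∈ S t, edge f t ε = e := by
  induction e with
  | _ a b =>
    simp only [unionGraph, classGraph, SimpleGraph.mem_edgeSet, SimpleGraph.iSup_adj,
      SimpleGraph.fromEdgeSet_adj, Set.mem_image, Finset.mem_coe]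
    constructor
    · rintro ⟨t, ⟨ε, h1, h2⟩, -⟩
      exact ⟨t, ε, h1, h2⟩
    · rintro ⟨t, ε, h1, h2⟩
      refine ⟨t, ⟨ε, h1, h2⟩, ?_⟩
      rintro rfl
      rcases Sym2.eq_iff.1 h2 with ⟨h3, h4⟩ | ⟨h3, h4⟩ <;>
        exact tail_ne_head t ε (f.injective (h3.trans h4.symm))

lemma ncard_edgeSet_unionGraph : (unionGraph f S).edgeSet.ncard = ∑ t, (S t).card := by
  classical
  have : (unionGraph f S).edgeSet =
      ((Finset.univ.sigma S).image fun a : (Σ _ : Fin 3, Slot D r p) => edge f a.1 a.2) := by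
    ext e
    rw [mem_edgeSet_unionGraph]
    simp
  rw [this, Set.ncard_coe_finset, Finset.card_image_of_injective, Finset.card_sigma]
  rintro ⟨t, ε⟩ ⟨t', ε'⟩ h
  obtain ⟨rfl, rfl⟩ := edge_inj h
  rfl

/-- The edges of the union, directed from tail to head. -/
def Arc (f : Vertex D r p ↪ Fin n) (S : Fin 3 → Finset (Slot D r p)) (a b : Fin n) : Prop :=
  ∃ t, ∃ ε ∈ S t, a = f (tail t ε) ∧ b = f (head t ε)

lemma arc_or_arc_of_adj {a b : Fin n} (h : (unionGraph f S).Adj a b) :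
    Arc f S a b ∨ Arc f S b a := by
  rw [← SimpleGraph.mem_edgeSet, mem_edgeSet_unionGraph] at h
  obtain ⟨t, ε, h1, h2⟩ := h
  rcases Sym2.eq_iff.1 h2 with ⟨h3, h4⟩ | ⟨h3, h4⟩
  · exact Or.inl ⟨t, ε, h1, h3.symm, h4.symm⟩
  · exact Or.inr ⟨t, ε, h1, h3.symm, h4.symm⟩

lemma eq_inl_of_head_eq_tail {t t' : Fin 3} {ε ε' : Slot D r p} (h : head t ε = tail t' ε') :
    ∃ i u v i' w, ε = Sum.inl (i, u, v) ∧ ε' = Sum.inl (i', v, w) ∧ t' = t + 1 ∧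
      pos (t + 1) i = pos (t + 1) i' := by
  rcases ε with ⟨i, u, v⟩ | ⟨a, b⟩ <;> rcases ε' with ⟨i', u', v'⟩ | ⟨a', b'⟩
  · simp only [tail, head, Sum.inl.injEq, Prod.mk.injEq] at h
    obtain ⟨rfl, h1, rfl⟩ := h
    exact ⟨i, u, v, i', v', rfl, rfl, rfl, h1⟩
  all_goals simp [tail, head] at h

lemma not_arc_transitive {a b c : Fin n} (h1 : Arc f S a b) (h2 : Arc f S b c)
    (h3 : Arc f S a c) : False := by
  obtain ⟨t1, ε1, -, ha, hb⟩ := h1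
  obtain ⟨t2, ε2, -, hb', hc⟩ := h2
  obtain ⟨t3, ε3, -, ha', hc'⟩ := h3
  obtain ⟨i, u, v, i', w, rfl, rfl, rfl, -⟩ :=
    eq_inl_of_head_eq_tail (f.injective (hb.symm.trans hb'))
  have e1 := f.injective (ha.symm.trans ha')
  have e2 := f.injective (hc.symm.trans hc')
  rcases ε3 with e | e
  · simp only [tail, head, Sum.inl.injEq, Prod.mk.injEq] at e1 e2
    have := e2.1
    rw [← e1.1] at this
    exact fin_three_ne_add_one (t1 + 1) this.symm
  · simp [tail] at e1

lemma fin_three_add : ∀ t : Fin 3, t + 1 + 1 + 1 = t := by decide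

lemma exists_block_of_arc_cycle {a b c : Fin n} (h1 : Arc f S a b) (h2 : Arc f S b c)
    (h3 : Arc f S c a) : ∃ t i u v w, s(a, b) = edge f t (Sum.inl (i, u, v)) ∧
      Sum.inl (i, u, v) ∈ S t ∧ Sum.inl (i, v, w) ∈ S (t + 1) ∧
      Sum.inl (i, w, u) ∈ S (t + 1 + 1) := by
  obtain ⟨t, ε1, m1, ha, hb⟩ := h1
  obtain ⟨t2, ε2, m2, hb', hc⟩ := h2
  obtain ⟨t3, ε3, m3, hc', ha'⟩ := h3
  obtain ⟨i, u, v, j, w, rfl, rfl, rfl, hij⟩ :=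
    eq_inl_of_head_eq_tail (f.injective (hb.symm.trans hb'))
  obtain ⟨j', v', w', k, u', h, rfl, rfl, hjk⟩ :=
    eq_inl_of_head_eq_tail (f.injective (hc.symm.trans hc'))
  simp only [Sum.inl.injEq, Prod.mk.injEq] at h
  obtain ⟨rfl, rfl, rfl⟩ := h
  obtain ⟨k', w'', u'', i', u''', h, h', -, hki⟩ :=
    eq_inl_of_head_eq_tail (f.injective (ha'.symm.trans ha))
  simp only [Sum.inl.injEq, Prod.mk.injEq] at h h'
  obtain ⟨rfl, rfl, rfl⟩ := h
  obtain ⟨rfl, rfl, rfl⟩ := h'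
  rw [fin_three_add] at hki
  obtain ⟨rfl, rfl⟩ := pos_triangle hij hjk hki
  exact ⟨t, _, _, _, _, by rw [ha, hb]; rfl, m1, m2, m3⟩

/-- Every triangle of the union lies in a block. -/
lemma exists_block_of_isTriangleEdge {e : Sym2 (Fin n)} (h : IsTriangleEdge (unionGraph f S) e) :
    ∃ t i u v w, e = edge f t (Sum.inl (i, u, v)) ∧
      Sum.inl (i, u, v) ∈ S t ∧ Sum.inl (i, v, w) ∈ S (t + 1) ∧
      Sum.inl (i, w, u) ∈ S (t + 1 + 1) := by
  obtain ⟨a, b, c, rfl, hab, hbc, hac⟩ := h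
  rcases arc_or_arc_of_adj hab with h1 | h1 <;> rcases arc_or_arc_of_adj hbc with h2 | h2 <;>
    rcases arc_or_arc_of_adj hac with h3 | h3
  · exact (not_arc_transitive h1 h2 h3).elim
  · exact exists_block_of_arc_cycle h1 h2 h3
  · exact (not_arc_transitive h3 h2 h1).elim
  · exact (not_arc_transitive h3 h1 h2).elim
  · exact (not_arc_transitive h1 h3 h2).elim
  · exact (not_arc_transitive h2 h3 h1).elim
  · rw [Sym2.eq_swap]
    exact exists_block_of_arc_cycle h1 h3 h2
  · exact (not_arc_transitive h2 h1 h3).elim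

end Graph

section Input

variable {D r p n : ℕ}

/-- Some set of `j` padding edges. -/
noncomputable def padding (p j : ℕ) : Finset (Fin p × Fin p) :=
  if h : j ≤ (Finset.univ : Finset (Fin p × Fin p)).card then
    (Finset.exists_subset_card_eq h).choose else ∅

lemma card_padding {j : ℕ} (h : j ≤ p * p) : (padding p j).card = j := by
  have h' : j ≤ (Finset.univ : Finset (Fin p × Fin p)).card := by simpa using h
  rw [padding, dif_pos h']
  exact (Finset.exists_subset_card_eq h').choose_spec.2

/-- The edges given by the random bits `x` of one class, padded to `μ` edges. -/
noncomputable def slots (p μ : ℕ) (x : CoreEdge D r → Bool) : Finset (Slot D r p) :=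
  (Finset.univ.filter fun e => x e = true).disjSum
    (padding p (μ - (Finset.univ.filter fun e => x e = true).card))

lemma inl_mem_slots {μ : ℕ} {x : CoreEdge D r → Bool} {e : CoreEdge D r} :
    Sum.inl e ∈ slots p μ x ↔ x e = true := by
  simp [slots]

lemma card_slots {μ : ℕ} {x : CoreEdge D r → Bool}
    (h : (Finset.univ.filter fun e => x e = true).card ≤ μ) (hp : μ ≤ p * p) :
    (slots p μ x).card = μ := by
  rw [slots, Finset.card_disjSum, card_padding (by omega)]
  omega

/-- The three classes of bits, indexed by `Fin 3`. -/
def bits {X : Type*} (z : X × X × X) : Fin 3 → X := ![z.1, z.2.1, z.2.2]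

/-- The edge of class `t` of a triangle. -/
def triEdge {I R : Type*} (τ : I × R × R × R) : Fin 3 → I × R × R :=
  ![(τ.1, τ.2.1, τ.2.2.1), (τ.1, τ.2.2.1, τ.2.2.2), (τ.1, τ.2.2.2, τ.2.1)]

lemma shares_of_triEdge_eq {I R : Type*} {τ τ' : I × R × R × R} (hne : τ ≠ τ') {t : Fin 3}
    (h : triEdge τ t = triEdge τ' t) : Shares τ τ' := by
  refine ⟨hne, ?_⟩
  fin_cases t
  · exact Or.inl h
  · exact Or.inr (Or.inl h)
  · exact Or.inr (Or.inr h)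

lemma bits_triEdge_of_present {I R : Type*} {z : (I × R × R → Bool) × (I × R × R → Bool) ×
    (I × R × R → Bool)} {τ : I × R × R × R} (h : present z τ = true) (t : Fin 3) :
    bits z t (triEdge τ t) = true := by
  simp only [present, Bool.and_eq_true] at h
  fin_cases t
  · exact h.1.1
  · exact h.1.2
  · exact h.2

/-- The input of the player of class `t`. -/
noncomputable def inputGraph (f : Vertex D r p ↪ Fin n) (μ : Fin 3 → ℕ) (t : Fin 3)
    (x : CoreEdge D r → Bool) : SimpleGraph (Fin n) :=
  classGraph f t (slots p (μ t) x)

variable (f : Vertex D r p ↪ Fin n) (μ : Fin 3 → ℕ)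

/-- Isolated triangles are edge-disjoint, and each of them has to lose an edge. -/
lemma card_isolatedTriangles_le (z : (CoreEdge D r → Bool) × (CoreEdge D r → Bool) ×
    (CoreEdge D r → Bool)) {H : SimpleGraph (Fin n)} (hH : H.CliqueFree 3) :
    (isolatedTriangles z).card
      ≤ (symmDiff (unionGraph f fun t => slots p (μ t) (bits z t)).edgeSet H.edgeSet).ncard := by
  have hex : ∀ τ ∈ isolatedTriangles z, ∃ t, edge f t (Sum.inl (triEdge τ t)) ∉ H.edgeSet := by
    intro τ _
    by_contra hcon
    push Not at hcon
    have h0 : H.Adj (f (Sum.inl (0, pos 0 τ.1, τ.2.1))) (f (Sum.inl (1, pos 1 τ.1, τ.2.2.1))) :=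
      hcon 0
    have h1 : H.Adj (f (Sum.inl (1, pos 1 τ.1, τ.2.2.1))) (f (Sum.inl (2, pos 2 τ.1, τ.2.2.2))) :=
      hcon 1
    have h2 : H.Adj (f (Sum.inl (2, pos 2 τ.1, τ.2.2.2))) (f (Sum.inl (0, pos 0 τ.1, τ.2.1))) :=
      hcon 2
    classical
    exact hH _ (SimpleGraph.is3Clique_triple_iff.2 ⟨h0, h2.symm, h1⟩)
  choose! t ht using hex
  rw [← Set.ncard_coe_finset]
  refine Set.ncard_le_ncard_of_injOn (fun τ => edge f (t τ) (Sum.inl (triEdge τ (t τ)))) ?_ ?_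
    (Set.toFinite _)
  · intro τ hτ
    refine Or.inl ⟨?_, ht τ hτ⟩
    rw [mem_edgeSet_unionGraph]
    refine ⟨t τ, _, inl_mem_slots.2 (bits_triEdge_of_present ?_ _), rfl⟩
    exact (Finset.mem_filter.1 hτ).2.1
  · intro τ hτ τ' hτ' h
    obtain ⟨h1, h2⟩ := edge_inj h
    rw [← h1] at h2
    by_contra hne
    exact (Finset.mem_filter.1 hτ).2.2 τ' (Finset.mem_filter.1 hτ').2.1
      (shares_of_triEdge_eq hne (Sum.inl.inj h2))

/-- The edge that follows `e` in the triangle of `e` with third vertex `v`. -/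
def nextEdge {I R : Type*} (e : I × R × R) (v : R) : I × R × R := (e.1, e.2.2, v)

/-- The edge that precedes `e` in the triangle of `e` with third vertex `v`. -/
def prevEdge {I R : Type*} (e : I × R × R) (v : R) : I × R × R := (e.1, v, e.2.1)

/-- The referee's output `e`, if it is a triangle edge, is one of the edges of a triangle that is
present in some block. -/
lemma exists_hit_of_isTriangleEdge {z : (CoreEdge D r → Bool) × (CoreEdge D r → Bool) ×
    (CoreEdge D r → Bool)} {e : Sym2 (Fin n)}
    (h : IsTriangleEdge (unionGraph f fun t => slots p (μ t) (bits z t)) e) :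
    ∃ t ε, e = edge f t (Sum.inl ε) ∧
      hit nextEdge prevEdge ε (bits z t) (bits z (t + 1)) (bits z (t + 1 + 1)) = true := by
  obtain ⟨t, i, u, v, w, he, h1, h2, h3⟩ := exists_block_of_isTriangleEdge h
  rw [inl_mem_slots] at h1 h2 h3
  refine ⟨t, (i, u, v), he, ?_⟩
  simp only [hit, Bool.and_eq_true, decide_eq_true_eq]
  exact ⟨h1, w, h2, h3⟩

end Input

/-! ### The three kinds of output -/

section Rotation

variable {I R : Type*} [Fintype I] [DecidableEq I] [Fintype R] [DecidableEq R]

lemma nextEdge_injective (e : I × R × R) : Function.Injective (nextEdge e) := fun v w h => by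
  simpa [nextEdge] using h

lemma prevEdge_injective (e : I × R × R) : Function.Injective (prevEdge e) := fun v w h => by
  simpa [prevEdge] using h

lemma nextEdge_prevEdge_injective : Function.Injective
    fun p : (I × R × R) × R => (nextEdge p.1 p.2, prevEdge p.1 p.2) := by
  rintro ⟨⟨i, u, v⟩, w⟩ ⟨⟨i', u', v'⟩, w'⟩ h
  simp only [nextEdge, prevEdge, Prod.mk.injEq] at h
  simp only [Prod.mk.injEq]
  tauto

/-- The Cauchy–Schwarz bound for the weighted number of triangles. -/
lemma sq_sum_triangles_le (a b c : I × R × R → ℝ) :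
    (∑ e, ∑ v, a e * (b (nextEdge e v) * c (prevEdge e v))) ^ 2
      ≤ (∑ e, a e ^ 2) * (∑ e, b e ^ 2) * ∑ e, c e ^ 2 := by
  simp only [← Finset.mul_sum]
  refine (Finset.sum_mul_sq_le_sq_mul_sq _ _ _).trans ?_
  rw [mul_assoc]
  refine mul_le_mul_of_nonneg_left ?_ (Finset.sum_nonneg fun e _ => sq_nonneg _)
  refine (Finset.sum_le_sum fun e _ => Finset.sum_mul_sq_le_sq_mul_sq Finset.univ
    (fun v => b (nextEdge e v)) fun v => c (prevEdge e v)).trans ?_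
  simp only [Fintype.sum_prod_type, nextEdge, prevEdge]
  have e1 : ∀ i : I, ∑ u : R, ∑ v : R, (∑ w, b (i, v, w) ^ 2) * ∑ w, c (i, w, u) ^ 2
      = (∑ v, ∑ w, b (i, v, w) ^ 2) * ∑ w, ∑ u, c (i, w, u) ^ 2 := fun i => by
    rw [Finset.sum_comm (f := fun w u => c (i, w, u) ^ 2)]
    simp only [← Finset.sum_mul, ← Finset.mul_sum]
  simp only [e1]
  rw [Finset.mul_sum]
  refine Finset.sum_le_sum fun i _ => mul_le_mul_of_nonneg_right ?_ (by positivity)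
  exact Finset.single_le_sum (f := fun i => ∑ v, ∑ w, b (i, v, w) ^ 2)
    (fun i _ => by positivity) (Finset.mem_univ i)

lemma exists_fin_three {P : Fin 3 → Prop} (h : ∃ t, P t) : P 0 ∨ P 1 ∨ P 2 := by
  obtain ⟨t, ht⟩ := h
  fin_cases t
  · exact Or.inl ht
  · exact Or.inr (Or.inl ht)
  · exact Or.inr (Or.inr ht)

lemma bits_zero {X : Type*} (z : X × X × X) : bits z 0 = z.1 := rfl

lemma bits_one {X : Type*} (z : X × X × X) : bits z 1 = z.2.1 := rfl

lemma bits_two {X : Type*} (z : X × X × X) : bits z 2 = z.2.2 := rfl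

section Reorder

variable {E : Type*} [Fintype E] [DecidableEq E] (q : ℝ)
  (F : (E → Bool) → (E → Bool) → (E → Bool) → ℝ)

lemma sum_tripleWeight_mul_eq : ∑ z, tripleWeight q z * F z.1 z.2.1 z.2.2
    = ∑ x, bernWeight q x * ∑ y, bernWeight q y * ∑ z, bernWeight q z * F x y z := by
  simp only [Fintype.sum_prod_type, tripleWeight, Finset.mul_sum]
  exact Finset.sum_congr rfl fun x _ => Finset.sum_congr rfl fun y _ =>
    Finset.sum_congr rfl fun z _ => by ring

lemma sum_tripleWeight_mul_eq_rotate : ∑ z, tripleWeight q z * F z.1 z.2.1 z.2.2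
    = ∑ y, bernWeight q y * ∑ z, bernWeight q z * ∑ x, bernWeight q x * F x y z := by
  simp only [Fintype.sum_prod_type, tripleWeight, Finset.mul_sum]
  rw [Finset.sum_comm]
  refine Finset.sum_congr rfl fun y _ => ?_
  rw [Finset.sum_comm]
  exact Finset.sum_congr rfl fun x _ => Finset.sum_congr rfl fun z _ => by ring

lemma sum_tripleWeight_mul_eq_rotate_rotate : ∑ z, tripleWeight q z * F z.1 z.2.1 z.2.2
    = ∑ z, bernWeight q z * ∑ x, bernWeight q x * ∑ y, bernWeight q y * F x y z := by
  rw [sum_tripleWeight_mul_eq]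
  simp only [Finset.mul_sum]
  refine Eq.trans (Finset.sum_congr rfl fun x _ => Finset.sum_comm) ?_
  rw [Finset.sum_comm]
  exact Finset.sum_congr rfl fun x _ => Finset.sum_congr rfl fun y _ =>
    Finset.sum_congr rfl fun z _ => by ring

end Reorder

variable {M₀ M₁ M₂ : Type*} [Fintype M₀] [DecidableEq M₀] [Fintype M₁] [DecidableEq M₁]
  [Fintype M₂] [DecidableEq M₂] {q : ℝ}
  (g₀ : (I × R × R → Bool) → M₀) (g₁ : (I × R × R → Bool) → M₁) (g₂ : (I × R × R → Bool) → M₂)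
  (o : Fin 3 → M₀ → M₁ → M₂ → I × R × R)

/-- The probability that, for some class `t`, the edge `o t` computed from the messages lies in a
triangle. -/
lemma sum_tripleWeight_le_of_hit (h0 : 0 ≤ q) (h1 : q ≤ 1)
    (P : (I × R × R → Bool) × (I × R × R → Bool) × (I × R × R → Bool) → Prop) [DecidablePred P]
    (hP : ∀ z, P z → ∃ t, hit nextEdge prevEdge (o t (g₀ z.1) (g₁ z.2.1) (g₂ z.2.2))
      (bits z t) (bits z (t + 1)) (bits z (t + 1 + 1)) = true) :
    ∑ z, tripleWeight q z * (if P z then 1 else 0)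
      ≤ hitProb q nextEdge prevEdge (o 0) g₀ g₁ g₂
        + hitProb q nextEdge prevEdge (fun b c a => o 1 a b c) g₁ g₂ g₀
        + hitProb q nextEdge prevEdge (fun c a b => o 2 a b c) g₂ g₀ g₁ := by
  have step : ∀ z, tripleWeight q z * (if P z then 1 else 0) ≤
      tripleWeight q z * (ind (hit nextEdge prevEdge (o 0 (g₀ z.1) (g₁ z.2.1) (g₂ z.2.2))
        z.1 z.2.1 z.2.2)
      + ind (hit nextEdge prevEdge (o 1 (g₀ z.1) (g₁ z.2.1) (g₂ z.2.2)) z.2.1 z.2.2 z.1)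
      + ind (hit nextEdge prevEdge (o 2 (g₀ z.1) (g₁ z.2.1) (g₂ z.2.2)) z.2.2 z.1 z.2.1)) := by
    intro z
    refine mul_le_mul_of_nonneg_left ?_ (tripleWeight_nonneg h0 h1 z)
    have n0 := ind_nonneg (hit nextEdge prevEdge (o 0 (g₀ z.1) (g₁ z.2.1) (g₂ z.2.2))
        z.1 z.2.1 z.2.2)
    have n1 := ind_nonneg (hit nextEdge prevEdge (o 1 (g₀ z.1) (g₁ z.2.1) (g₂ z.2.2))
        z.2.1 z.2.2 z.1)
    have n2 := ind_nonneg (hit nextEdge prevEdge (o 2 (g₀ z.1) (g₁ z.2.1) (g₂ z.2.2))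
        z.2.2 z.1 z.2.1)
    have i1 : ind true = 1 := by simp [ind]
    split_ifs with hz
    · rcases exists_fin_three (hP z hz) with ht | ht | ht
      · rw [bits_zero, zero_add, bits_one, show (1 + 1 : Fin 3) = 2 from rfl, bits_two] at ht
        rw [ht, i1]; linarith
      · rw [bits_one, show (1 + 1 : Fin 3) = 2 from rfl, bits_two,
          show (2 + 1 : Fin 3) = 0 from rfl, bits_zero] at ht
        rw [ht, i1]; linarith
      · rw [bits_two, show (2 + 1 : Fin 3) = 0 from rfl, bits_zero, zero_add, bits_one] at ht
        rw [ht, i1]; linarith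
    · linarith
  refine (Finset.sum_le_sum fun z _ => step z).trans (le_of_eq ?_)
  simp only [mul_add, Finset.sum_add_distrib]
  congr 1
  congr 1
  · exact sum_tripleWeight_mul_eq q fun x y z =>
      ind (hit nextEdge prevEdge (o 0 (g₀ x) (g₁ y) (g₂ z)) x y z)
  · exact sum_tripleWeight_mul_eq_rotate q fun x y z =>
      ind (hit nextEdge prevEdge (o 1 (g₀ x) (g₁ y) (g₂ z)) y z x)
  · exact sum_tripleWeight_mul_eq_rotate_rotate q fun x y z =>
      ind (hit nextEdge prevEdge (o 2 (g₀ x) (g₁ y) (g₂ z)) z x y)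

/-- The success probability of a referee who sees three short messages. -/
lemma success_le_simultaneous [Nonempty M₀] [Nonempty M₁] [Nonempty M₂] (h0 : 0 ≤ q) (h1 : q ≤ 1)
    (P : (I × R × R → Bool) × (I × R × R → Bool) × (I × R × R → Bool) → Prop) [DecidablePred P]
    (hP : ∀ z, P z → ∃ t, hit nextEdge prevEdge (o t (g₀ z.1) (g₁ z.2.1) (g₂ z.2.2))
      (bits z t) (bits z (t + 1)) (bits z (t + 1 + 1)) = true)
    {l κ : ℝ} (hl0 : Real.log (Fintype.card M₀) ≤ l) (hl1 : Real.log (Fintype.card M₁) ≤ l)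
    (hl2 : Real.log (Fintype.card M₂) ≤ l) (hκ : 0 ≤ κ) (hl : (q * l) ^ 3 ≤ κ ^ 2) :
    ∑ z, tripleWeight q z * (if P z then 1 else 0)
      ≤ 3 * (2 * q + 4 * q ^ 2 * Fintype.card R + 4 * q * l + κ) := by
  have b0 := hitProb_le_simultaneous (o 0) g₀ g₁ g₂ h0 h1 nextEdge_injective prevEdge_injective
    sq_sum_triangles_le hl0 hl1 hl2 hκ hl
  have b1 := hitProb_le_simultaneous (fun b c a => o 1 a b c) g₁ g₂ g₀ h0 h1 nextEdge_injective
    prevEdge_injective sq_sum_triangles_le hl1 hl2 hl0 hκ hl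
  have b2 := hitProb_le_simultaneous (fun c a b => o 2 a b c) g₂ g₀ g₁ h0 h1 nextEdge_injective
    prevEdge_injective sq_sum_triangles_le hl2 hl0 hl1 hκ hl
  have := sum_tripleWeight_le_of_hit g₀ g₁ g₂ o h0 h1 P hP
  linarith

/-- The success probability of a referee who sees two short messages and the whole third class. -/
lemma success_le_oneWay [Nonempty M₀] [Nonempty M₁] [Nonempty R] (h0 : 0 < q) (h1 : q ≤ 1)
    (P : (I × R × R → Bool) × (I × R × R → Bool) × (I × R × R → Bool) → Prop) [DecidablePred P]
    (hP : ∀ z, P z → ∃ t, hit nextEdge prevEdge (o t (g₀ z.1) (g₁ z.2.1) (g₂ z.2.2))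
      (bits z t) (bits z (t + 1)) (bits z (t + 1 + 1)) = true)
    {l : ℝ} (hl0 : Real.log (Fintype.card M₀) ≤ l) (hl1 : Real.log (Fintype.card M₁) ≤ l) :
    ∑ z, tripleWeight q z * (if P z then 1 else 0)
      ≤ 4 * q + 12 * q ^ 2 * Fintype.card R + 8 * q * l + 3 * (q * l ^ 2) := by
  have b0 := hitProb_le_oneWay_side (φ := nextEdge) (ψ := prevEdge) (o 0) g₀ g₁ g₂ h0 h1
    prevEdge_injective nextEdge_injective hl0 hl1
  have b1 := hitProb_le_oneWay_side (φ := prevEdge) (ψ := nextEdge) (fun b a c => o 1 a b c)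
    g₁ g₀ g₂ h0 h1 nextEdge_injective prevEdge_injective hl1 hl0
  have b2 := hitProb_le_oneWay (fun c a b => o 2 a b c) g₂ g₀ g₁ h0.le h1 nextEdge_injective
    prevEdge_injective nextEdge_prevEdge_injective hl0 hl1
  have := sum_tripleWeight_le_of_hit g₀ g₁ g₂ o h0.le h1 P hP
  rw [hitProb_swap (fun b c a => o 1 a b c) g₁ g₂ g₀] at this
  linarith

end Rotation

/-! ### From protocols to success probabilities -/

section Message

/-- The bit strings of length at most `L`. -/
abbrev Message (L : ℕ) := Σ l : Fin (L + 1), List.Vector Bool l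

/-- The message `s`, replaced by the empty message if it is longer than `L`. -/
def truncate (L : ℕ) (s : List Bool) : Message L :=
  if h : s.length ≤ L then ⟨⟨s.length, Nat.lt_succ_of_le h⟩, ⟨s, rfl⟩⟩ else ⟨0, List.Vector.nil⟩

lemma toList_truncate {L : ℕ} {s : List Bool} (h : s.length ≤ L) : (truncate L s).2.toList = s := by
  rw [truncate, dif_pos h]
  rfl

instance (L : ℕ) : Nonempty (Message L) := ⟨truncate L []⟩

lemma log_card_message_le (L : ℕ) : Real.log (Fintype.card (Message L)) ≤ L + 1 := by
  have hsum : ∀ m : ℕ, ∑ i ∈ Finset.range m, 2 ^ i ≤ 2 ^ m := fun m => by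
    induction m with
    | zero => simp
    | succ m ih => rw [Finset.sum_range_succ, pow_succ]; omega
  have hc : Fintype.card (Message L) ≤ 2 ^ (L + 1) := by
    rw [Fintype.card_sigma]
    simp only [card_vector, Fintype.card_bool]
    rw [Fin.sum_univ_eq_sum_range (fun i => 2 ^ i)]
    exact hsum _
  have hpos : 0 < Fintype.card (Message L) := Fintype.card_pos
  calc Real.log (Fintype.card (Message L)) ≤ Real.log ((2 : ℝ) ^ (L + 1)) :=
        Real.log_le_log (by exact_mod_cast hpos) (by exact_mod_cast hc)
    _ = (L + 1) * Real.log 2 := by rw [Real.log_pow]; push_cast; ring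
    _ ≤ (L + 1) * 1 := by
        refine mul_le_mul_of_nonneg_left ?_ (by positivity)
        linarith [Real.log_two_lt_d9]
    _ = L + 1 := mul_one _

end Message

section Protocol

variable {k : ℕ} {X Y : Type} (p : SimProtocol k X Y)

lemma measurableSet_correct [Countable Y] (T : SearchProblem k X Y) (x : Fin k → X) :
    MeasurableSet[p.mΩ] {ω | T.correct x (p.run ω x)} := by
  let _ := p.mΩ
  have : {ω | T.correct x (p.run ω x)} = ⋃ s : Fin k → List Bool, ⋃ y : {y // T.correct x y},
      (⋂ j, {ω | p.msg j ω (x j) = s j}) ∩ {ω | p.out ω s = y} := by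
    ext ω
    simp only [Set.mem_ofPred_eq, Set.mem_iUnion, Set.mem_inter_iff, Set.mem_iInter]
    constructor
    · intro h
      exact ⟨fun j => p.msg j ω (x j), ⟨_, h⟩, fun _ => rfl, rfl⟩
    · rintro ⟨s, ⟨y, hy⟩, h1, h2⟩
      have hs : (fun j => p.msg j ω (x j)) = s := funext h1
      rw [SimProtocol.run, hs, h2]
      exact hy
  rw [this]
  exact MeasurableSet.iUnion fun s => MeasurableSet.iUnion fun y =>
    (MeasurableSet.iInter fun j => p.measurable_msg j (x j) (s j)).inter (p.measurable_out s y)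

lemma measurable_length (j : Fin k) (x : X) :
    @Measurable p.Ω ℕ p.mΩ _ fun ω => (p.msg j ω x).length := by
  let _ := p.mΩ
  refine measurable_to_countable' fun l => ?_
  have : (fun ω => (p.msg j ω x).length) ⁻¹' {l} =
      ⋃ s : {s : List Bool // s.length = l}, {ω | p.msg j ω x = s} := by
    ext ω
    simp
  rw [this]
  exact MeasurableSet.iUnion fun s => p.measurable_msg j x s

/-- The probability that the message of player `j` on the input `x` is longer than `L`. -/
noncomputable def longProb (L : ℕ) (j : Fin k) (x : X) : ℝ :=
  (@Measure.real p.Ω p.mΩ p.prob) {ω | L < (p.msg j ω x).length}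

lemma longProb_nonneg (L : ℕ) (j : Fin k) (x : X) : 0 ≤ longProb p L j x := ENNReal.toReal_nonneg

lemma measurableSet_long (L : ℕ) (j : Fin k) (x : X) :
    MeasurableSet[p.mΩ] {ω | L < (p.msg j ω x).length} := by
  let _ := p.mΩ
  exact measurableSet_lt measurable_const (measurable_length p j x)

lemma sum_longProb_le (L : ℕ) (x : Fin k → X) {b : ℝ} (hb : 0 ≤ b)
    (h : p.expectedBits x ≤ ENNReal.ofReal b) :
    ∑ j, longProb p L j (x j) ≤ b / (L + 1) := by
  let _ := p.mΩ
  have := p.isProb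
  have hmeas : ∀ j, Measurable fun ω => ((p.msg j ω (x j)).length : ℝ≥0∞) := fun j =>
    (measurable_from_nat (f := fun l : ℕ => (l : ℝ≥0∞))).comp (measurable_length p j (x j))
  have markov : ∀ j, ((L + 1 : ℕ) : ℝ≥0∞) * p.prob {ω | L < (p.msg j ω (x j)).length}
      ≤ ∫⁻ ω, ((p.msg j ω (x j)).length : ℝ≥0∞) ∂p.prob := fun j => by
    refine le_trans (le_of_eq ?_) (mul_meas_ge_le_lintegral (hmeas j) ((L + 1 : ℕ) : ℝ≥0∞))
    congr 2
    ext ω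
    simp only [Set.mem_ofPred_eq, Nat.cast_le]
    omega
  have hsum : ((L + 1 : ℕ) : ℝ≥0∞) * ∑ j, p.prob {ω | L < (p.msg j ω (x j)).length}
      ≤ ENNReal.ofReal b := by
    rw [Finset.mul_sum]
    refine (Finset.sum_le_sum fun j _ => markov j).trans (le_trans (le_of_eq ?_) h)
    rw [SimProtocol.expectedBits, lintegral_finsetSum _ fun j _ => hmeas j]
  have hreal := ENNReal.toReal_mono ENNReal.ofReal_ne_top hsum
  rw [ENNReal.toReal_ofReal hb, ENNReal.toReal_mul, ENNReal.toReal_natCast,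
    ENNReal.toReal_sum fun j _ => measure_ne_top _ _] at hreal
  rw [le_div_iff₀ (by positivity), mul_comm]
  push_cast at hreal
  exact hreal

/-- Averaging over the shared randomness: if the inputs `z` are random with weights `w`, if for each
random string the referee is correct with probability at most `s` while the messages are short, and
if the messages are too long with probability at most `β`, then valid inputs are unlikely. -/
lemma prob_valid_le_of_success_le {Ω Z : Type*} [MeasurableSpace Ω] (P : Measure Ω)
    [IsProbabilityMeasure P] [Fintype Z] (w : Z → ℝ) (hw : ∀ z, 0 ≤ w z) (hw1 : ∑ z, w z = 1)
    (V : Z → Prop) (Cor Short : Z → Set Ω) (hCor : ∀ z, MeasurableSet (Cor z))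
    (hShort : ∀ z, MeasurableSet (Short z)) {δ s β : ℝ} (hδ : 0 ≤ δ)
    (herr : ∀ z, V z → P.real (Cor z)ᶜ ≤ δ)
    (hs : ∀ ω, ∑ z, w z * (Cor z ∩ Short z).indicator 1 ω ≤ s)
    (hβ : ∑ z, w z * (P.real (Short z)ᶜ * {z | V z}.indicator 1 z) ≤ β) :
    ∑ z, w z * {z | V z}.indicator 1 z ≤ δ + s + β := by
  have hmeas : ∀ z, MeasurableSet (Cor z ∩ Short z) := fun z => (hCor z).inter (hShort z)
  have hint : ∀ z, Integrable (fun ω => w z * (Cor z ∩ Short z).indicator (1 : Ω → ℝ) ω) P :=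
    fun z => ((integrable_const (1 : ℝ)).indicator (hmeas z)).const_mul (w z)
  have hsucc : ∑ z, w z * P.real (Cor z ∩ Short z) ≤ s := by
    have h1 : ∫ ω, ∑ z, w z * (Cor z ∩ Short z).indicator (1 : Ω → ℝ) ω ∂P
        = ∑ z, w z * P.real (Cor z ∩ Short z) := by
      rw [integral_finsetSum _ fun z _ => hint z]
      refine Finset.sum_congr rfl fun z _ => ?_
      rw [integral_const_mul, integral_indicator_one (hmeas z)]
    rw [← h1]
    have h2 := integral_mono (μ := P) (integrable_finsetSum Finset.univ fun z _ => hint z)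
      (integrable_const s) hs
    simpa using h2
  have point : ∀ z, w z * {z | V z}.indicator 1 z
      ≤ w z * δ + w z * P.real (Cor z ∩ Short z)
        + w z * (P.real (Short z)ᶜ * {z | V z}.indicator 1 z) := by
    intro z
    rw [← mul_add, ← mul_add]
    refine mul_le_mul_of_nonneg_left ?_ (hw z)
    by_cases hz : V z
    · have hi : {z | V z}.indicator (1 : Z → ℝ) z = 1 := by simp [hz]
      rw [hi, mul_one]
      have hcover : (Set.univ : Set Ω) ⊆ (Cor z)ᶜ ∪ (Cor z ∩ Short z) ∪ (Short z)ᶜ := by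
        intro ω _
        by_cases h1 : ω ∈ Cor z <;> by_cases h2 : ω ∈ Short z <;> simp [h1, h2]
      have h1 := measureReal_mono (μ := P) hcover
      have h2 := measureReal_union_le (μ := P) ((Cor z)ᶜ ∪ (Cor z ∩ Short z)) (Short z)ᶜ
      have h3 := measureReal_union_le (μ := P) (Cor z)ᶜ (Cor z ∩ Short z)
      have h4 : P.real Set.univ = 1 := by simp
      linarith [herr z hz]
    · have hi : {z | V z}.indicator (1 : Z → ℝ) z = 0 := by simp [hz]
      rw [hi, mul_zero, add_zero]
      exact add_nonneg hδ measureReal_nonneg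
  refine (Finset.sum_le_sum fun z _ => point z).trans ?_
  rw [Finset.sum_add_distrib, Finset.sum_add_distrib, ← Finset.sum_mul, hw1, one_mul]
  linarith

end Protocol

section Reduction

-- the instance `Fintype` on triples of families of bits exceeds the default size
set_option synthInstance.maxSize 1000

variable {D r p n k : ℕ} (f : Vertex D r p ↪ Fin n) (μ : Fin 3 → ℕ)

/-- The inputs of the players when player `h` receives the class `a h`. -/
noncomputable def inputs (a : Fin k → Fin 3) (z : (CoreEdge D r → Bool) × (CoreEdge D r → Bool) ×
    (CoreEdge D r → Bool)) : Fin k → SimpleGraph (Fin n) :=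
  fun h => inputGraph f μ (a h) (bits z (a h))

lemma iSup_inputs {a : Fin k → Fin 3} (ha : Function.Surjective a)
    (z : (CoreEdge D r → Bool) × (CoreEdge D r → Bool) × (CoreEdge D r → Bool)) :
    ⨆ h, inputs f μ a z h = unionGraph f fun t => slots p (μ t) (bits z t) :=
  ha.iSup_comp (g := fun t => inputGraph f μ t (bits z t))

open Classical in
/-- The core edge that the output `e` of the referee stands for, when it is an edge of class `t`. -/
noncomputable def decodeEdge (f : Vertex D r p ↪ Fin n) [Nonempty (CoreEdge D r)] (t : Fin 3)
    (e : Sym2 (Fin n)) : CoreEdge D r :=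
  if h : ∃ ε, e = edge f t (Sum.inl ε) then h.choose else Classical.arbitrary _

lemma decodeEdge_edge [Nonempty (CoreEdge D r)] (t : Fin 3) (ε : CoreEdge D r) :
    decodeEdge f t (edge f t (Sum.inl ε)) = ε := by
  have h : ∃ ε', edge f t (Sum.inl ε) = edge f t (Sum.inl ε') := ⟨ε, rfl⟩
  rw [decodeEdge, dif_pos h]
  exact (Sum.inl.inj (edge_inj h.choose_spec).2).symm

lemma exists_hit_decodeEdge [Nonempty (CoreEdge D r)] {z : (CoreEdge D r → Bool) ×
    (CoreEdge D r → Bool) × (CoreEdge D r → Bool)} {e : Sym2 (Fin n)}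
    (h : IsTriangleEdge (unionGraph f fun t => slots p (μ t) (bits z t)) e) :
    ∃ t, hit nextEdge prevEdge (decodeEdge f t e) (bits z t) (bits z (t + 1))
      (bits z (t + 1 + 1)) = true := by
  obtain ⟨t, ε, rfl, ht⟩ := exists_hit_of_isTriangleEdge f μ h
  exact ⟨t, by rw [decodeEdge_edge]; exact ht⟩

variable {ε d δ q b : ℝ} {V : (CoreEdge D r → Bool) × (CoreEdge D r → Bool) ×
  (CoreEdge D r → Bool) → Prop} (P : SimProtocol k (SimpleGraph (Fin n)) (Sym2 (Fin n)))

/-- The probability that the input is valid and that the message of player `h`, on the class `t`,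
is longer than `L`. -/
noncomputable def longValid (q : ℝ) (V : (CoreEdge D r → Bool) × (CoreEdge D r → Bool) ×
    (CoreEdge D r → Bool) → Prop) (L : ℕ) (h : Fin k) (t : Fin 3) : ℝ :=
  ∑ z, tripleWeight q z * (longProb P L h (inputGraph f μ t (bits z t)) *
    {z | V z}.indicator 1 z)

lemma longValid_nonneg (h0 : 0 ≤ q) (h1 : q ≤ 1) (L : ℕ) (h : Fin k) (t : Fin 3) :
    0 ≤ longValid f μ P q V L h t :=
  Finset.sum_nonneg fun z _ => mul_nonneg (tripleWeight_nonneg h0 h1 z)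
    (mul_nonneg (longProb_nonneg P L h _) (Set.indicator_nonneg (fun _ _ => zero_le_one) _))

lemma sum_longValid_le (h0 : 0 ≤ q) (h1 : q ≤ 1) (hb : 0 ≤ b) {a : Fin k → Fin 3}
    (hcost : ∀ z, V z → P.expectedBits (inputs f μ a z) ≤ ENNReal.ofReal b) (L : ℕ) :
    ∑ h, longValid f μ P q V L h (a h) ≤ b / (L + 1) := by
  unfold longValid
  rw [Finset.sum_comm]
  have hb' : 0 ≤ b / (L + 1) := by positivity
  have : ∀ z, ∑ h, tripleWeight q z * (longProb P L h (inputGraph f μ (a h) (bits z (a h))) *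
      {z | V z}.indicator 1 z) ≤ tripleWeight q z * (b / (L + 1)) := fun z => by
    rw [← Finset.mul_sum, ← Finset.sum_mul]
    refine mul_le_mul_of_nonneg_left ?_ (tripleWeight_nonneg h0 h1 z)
    by_cases hz : V z
    · rw [Set.indicator_of_mem (show z ∈ {z | V z} from hz), Pi.one_apply, mul_one]
      exact sum_longProb_le P L (inputs f μ a z) hb (hcost z hz)
    · rw [Set.indicator_of_notMem (show z ∉ {z | V z} from hz), mul_zero]
      exact hb'
  refine (Finset.sum_le_sum fun z _ => this z).trans (le_of_eq ?_)
  rw [← Finset.sum_mul, sum_tripleWeight, one_mul]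

/-- Valid inputs are unlikely if three players solve the task with short messages. -/
lemma prob_valid_le_three [Nonempty (CoreEdge D r)]
    (P : SimProtocol 3 (SimpleGraph (Fin n)) (Sym2 (Fin n)))
    (h0 : 0 ≤ q) (h1 : q ≤ 1) (hb : 0 ≤ b) (hδ : δ < 1 / 100)
    (hV : ∀ z, V z → inputs f μ id z ∈ (triangleEdgeTask 3 n ε d).valid)
    (hP : P.Solves (triangleEdgeTask 3 n ε d) δ)
    (hcost : ∀ z, V z → P.expectedBits (inputs f μ id z) ≤ ENNReal.ofReal b) (L : ℕ)
    {κ : ℝ} (hκ : 0 ≤ κ) (hl : (q * (L + 1)) ^ 3 ≤ κ ^ 2) :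
    ∑ z, tripleWeight q z * {z | V z}.indicator 1 z ≤ 1 / 100
      + 3 * (2 * q + 4 * q ^ 2 * r + 4 * q * (L + 1) + κ) + b / (L + 1) := by
  classical
  let _ := P.mΩ
  have := P.isProb
  refine prob_valid_le_of_success_le P.prob (tripleWeight q) (tripleWeight_nonneg h0 h1)
    (sum_tripleWeight q) V
    (fun z => {ω | IsTriangleEdge (⨆ h, inputs f μ id z h) (P.run ω (inputs f μ id z))})
    (fun z => ⋂ h, {ω | L < (P.msg h ω (inputs f μ id z h)).length}ᶜ)
    (fun z => measurableSet_correct P (triangleEdgeTask 3 n ε d) (inputs f μ id z))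
    (fun z => MeasurableSet.iInter fun h => (measurableSet_long P L h _).compl)
    (by norm_num) (fun z hz => ?_) (fun ω => ?_) ?_
  · exact (hP _ (hV z hz)).trans hδ.le
  · have := success_le_simultaneous (q := q)
      (fun x => truncate L (P.msg 0 ω (inputGraph f μ 0 x)))
      (fun x => truncate L (P.msg 1 ω (inputGraph f μ 1 x)))
      (fun x => truncate L (P.msg 2 ω (inputGraph f μ 2 x)))
      (fun t a b c => decodeEdge f t (P.out ω ![a.2.toList, b.2.toList, c.2.toList])) h0 h1
      (fun z => ω ∈ {ω | IsTriangleEdge (⨆ h, inputs f μ id z h) (P.run ω (inputs f μ id z))} ∩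
        ⋂ h, {ω | L < (P.msg h ω (inputs f μ id z h)).length}ᶜ) ?_
      (log_card_message_le L) (log_card_message_le L) (log_card_message_le L) hκ hl
    · rw [Fintype.card_fin] at this
      simpa [Set.indicator_apply] using this
    · rintro z ⟨hc, hs⟩
      simp only [Set.mem_iInter, Set.mem_compl_iff, Set.mem_ofPred_eq, not_lt] at hs
      have hrun : P.run ω (inputs f μ id z) = P.out ω
          ![(truncate L (P.msg 0 ω (inputGraph f μ 0 z.1))).2.toList,
            (truncate L (P.msg 1 ω (inputGraph f μ 1 z.2.1))).2.toList,
            (truncate L (P.msg 2 ω (inputGraph f μ 2 z.2.2))).2.toList] := by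
        unfold SimProtocol.run
        congr 1
        funext h
        fin_cases h
        · exact (toList_truncate (hs 0)).symm
        · exact (toList_truncate (hs 1)).symm
        · exact (toList_truncate (hs 2)).symm
      rw [Set.mem_ofPred_eq, iSup_inputs f μ Function.surjective_id, hrun] at hc
      exact exists_hit_decodeEdge f μ hc
  · refine le_trans ?_ (sum_longValid_le f μ P h0 h1 hb hcost L)
    unfold longValid
    rw [Finset.sum_comm]
    refine Finset.sum_le_sum fun z _ => ?_
    rw [← Finset.mul_sum, ← Finset.sum_mul]
    refine mul_le_mul_of_nonneg_left (mul_le_mul_of_nonneg_right ?_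
      (Set.indicator_nonneg (fun _ _ => zero_le_one) _)) (tripleWeight_nonneg h0 h1 z)
    rw [Set.compl_iInter]
    simp only [compl_compl]
    exact measureReal_iUnion_fintype_le _

/-- The assignment of classes in which player `i` receives the class `t + 1`, player `j` the class
`t + 2`, and all others the class `t`. -/
def assign (i j : Fin k) (t : Fin 3) (h : Fin k) : Fin 3 :=
  if h = i then t + 1 else if h = j then t + 1 + 1 else t

lemma fin_three_cover : ∀ t t' : Fin 3, t' = t + 1 ∨ t' = t + 1 + 1 ∨ t' = t := by decide

lemma assign_surjective (hk : 3 ≤ k) {i j : Fin k} (hij : i ≠ j) (t : Fin 3) :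
    Function.Surjective (assign i j t) := by
  obtain ⟨h, hh⟩ : ∃ h, h ∉ ({i, j} : Finset (Fin k)) := by
    by_contra hcon
    push Not at hcon
    have h1 := Finset.card_le_card fun x (_ : x ∈ Finset.univ) => hcon x
    have h2 := Finset.card_le_two (a := i) (b := j)
    rw [Finset.card_univ, Fintype.card_fin] at h1
    omega
  simp only [Finset.mem_insert, Finset.mem_singleton, not_or] at hh
  intro t'
  rcases fin_three_cover t t' with rfl | rfl | rfl
  · exact ⟨i, by simp [assign]⟩
  · exact ⟨j, by simp [assign, hij.symm]⟩
  · exact ⟨h, by simp [assign, hh.1, hh.2]⟩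

/-- Among the players that receive the same class `t`, some player sends a short message. -/
lemma exists_longValid_le (h0 : 0 ≤ q) (h1 : q ≤ 1) (hb : 0 ≤ b) (hk : 3 ≤ k) {i j : Fin k}
    (hij : i ≠ j) (t : Fin 3)
    (hcost : ∀ z, V z → P.expectedBits (inputs f μ (assign i j t) z) ≤ ENNReal.ofReal b) (L : ℕ) :
    ∃ h, h ≠ i ∧ h ≠ j ∧ (k - 2) * longValid f μ P q V L h t ≤ b / (L + 1) := by
  have hsum := sum_longValid_le f μ P h0 h1 hb hcost L
  by_contra hcon
  push Not at hcon
  have hk' : (3 : ℝ) ≤ k := by exact_mod_cast hk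
  set S : Finset (Fin k) := (Finset.univ.erase i).erase j with hS
  have hcard : (S.card : ℝ) = k - 2 := by
    have : S.card = k - 2 := by
      rw [hS, Finset.card_erase_of_mem (Finset.mem_erase.2 ⟨hij.symm, Finset.mem_univ j⟩),
        Finset.card_erase_of_mem (Finset.mem_univ i), Finset.card_univ, Fintype.card_fin]
      omega
    rw [this, Nat.cast_sub (by omega)]
    norm_num
  have hSpos : S.Nonempty := by
    rw [← Finset.card_pos]
    have : (0 : ℝ) < S.card := by rw [hcard]; linarith
    exact_mod_cast this
  have hmem : ∀ h ∈ S, h ≠ i ∧ h ≠ j := fun h hh => by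
    simp only [hS, Finset.mem_erase, Finset.mem_univ, and_true] at hh
    exact ⟨hh.2, hh.1⟩
  have h2 : ∑ h ∈ S, (k - 2) * longValid f μ P q V L h t ≤ (k - 2) * (b / (L + 1)) := by
    rw [← Finset.mul_sum]
    refine mul_le_mul_of_nonneg_left (le_trans ?_ hsum) (by linarith)
    refine le_trans (le_of_eq ?_) (Finset.sum_le_sum_of_subset_of_nonneg (Finset.subset_univ S)
      fun h _ _ => longValid_nonneg f μ P h0 h1 L h _)
    refine Finset.sum_congr rfl fun h hh => ?_
    rw [assign, if_neg (hmem h hh).1, if_neg (hmem h hh).2]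
  have h3 := Finset.sum_lt_sum_of_nonempty hSpos fun h hh => hcon h (hmem h hh).1 (hmem h hh).2
  rw [Finset.sum_const, nsmul_eq_mul, hcard] at h3
  linarith

/-- Valid inputs are unlikely if many players solve the task with short messages. Two players with
short messages receive two of the classes, and all others receive the third class, so that the
referee learns nothing but this class from them. -/
lemma prob_valid_le_many [Nonempty (CoreEdge D r)] [Nonempty (Fin r)]
    (h0 : 0 < q) (h1 : q ≤ 1) (hb : 0 ≤ b) (hk : 3 < k) (hδ : δ < 1 / 100)
    (hV : ∀ a : Fin k → Fin 3, Function.Surjective a → ∀ z, V z →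
      inputs f μ a z ∈ (triangleEdgeTask k n ε d).valid)
    (hP : P.Solves (triangleEdgeTask k n ε d) δ)
    (hcost : ∀ x ∈ (triangleEdgeTask k n ε d).valid, P.expectedBits x ≤ ENNReal.ofReal b) (L : ℕ) :
    ∑ z, tripleWeight q z * {z | V z}.indicator 1 z ≤ 1 / 100
      + (4 * q + 12 * q ^ 2 * r + 8 * q * (L + 1) + 3 * (q * (L + 1) ^ 2))
      + 4 * (b / k) / (L + 1) := by
  classical
  let _ := P.mΩ
  have := P.isProb
  have hne : (⟨0, by omega⟩ : Fin k) ≠ ⟨1, by omega⟩ := by simp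
  obtain ⟨i, hi, -, hiL⟩ := exists_longValid_le f μ P h0.le h1 hb (by omega) hne 0
    (fun z hz => hcost _ (hV _ (assign_surjective (by omega) hne 0) z hz)) L
  obtain ⟨j, -, hj, hjL⟩ := exists_longValid_le f μ P h0.le h1 hb (by omega) hi.symm 1
    (fun z hz => hcost _ (hV _ (assign_surjective (by omega) hi.symm 1) z hz)) L
  have hsurj := assign_surjective (k := k) (by omega) hj.symm 2
  set a := assign i j 2 with ha
  have hai : a i = 0 := by simp [ha, assign]
  have haj : a j = 1 := by simp [ha, assign, hj]
  have hao : ∀ h, h ≠ i → h ≠ j → a h = 2 := fun h h1 h2 => by simp [ha, assign, h1, h2]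
  refine prob_valid_le_of_success_le P.prob (tripleWeight q) (tripleWeight_nonneg h0.le h1)
    (sum_tripleWeight q) V
    (fun z => {ω | IsTriangleEdge (⨆ h, inputs f μ a z h) (P.run ω (inputs f μ a z))})
    (fun z => ({ω | L < (P.msg i ω (inputs f μ a z i)).length} ∪
      {ω | L < (P.msg j ω (inputs f μ a z j)).length})ᶜ)
    (fun z => measurableSet_correct P (triangleEdgeTask k n ε d) (inputs f μ a z))
    (fun z => ((measurableSet_long P L i _).union (measurableSet_long P L j _)).compl)
    (by norm_num) (fun z hz => ?_) (fun ω => ?_) ?_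
  · exact (hP _ (hV a hsurj z hz)).trans hδ.le
  · have := success_le_oneWay (q := q)
      (fun x => truncate L (P.msg i ω (inputGraph f μ 0 x)))
      (fun x => truncate L (P.msg j ω (inputGraph f μ 1 x)))
      (fun x : CoreEdge D r → Bool => x)
      (fun t m₀ m₁ x => decodeEdge f t (P.out ω fun h => if h = i then m₀.2.toList else
        if h = j then m₁.2.toList else P.msg h ω (inputGraph f μ 2 x))) h0 h1
      (fun z => ω ∈ {ω | IsTriangleEdge (⨆ h, inputs f μ a z h) (P.run ω (inputs f μ a z))} ∩
        ({ω | L < (P.msg i ω (inputs f μ a z i)).length} ∪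
      {ω | L < (P.msg j ω (inputs f μ a z j)).length})ᶜ) ?_
      (log_card_message_le L) (log_card_message_le L)
    · rw [Fintype.card_fin] at this
      simpa [Set.indicator_apply] using this
    · rintro z ⟨hc, hs⟩
      simp only [Set.mem_compl_iff, Set.mem_union, Set.mem_ofPred_eq, not_or, not_lt] at hs
      have hrun : P.run ω (inputs f μ a z) = P.out ω fun h =>
          if h = i then (truncate L (P.msg i ω (inputGraph f μ 0 z.1))).2.toList else
          if h = j then (truncate L (P.msg j ω (inputGraph f μ 1 z.2.1))).2.toList else
          P.msg h ω (inputGraph f μ 2 z.2.2) := by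
        unfold SimProtocol.run
        congr 1
        funext h
        split_ifs with e1 e2
        · subst e1
          have e : inputs f μ a z h = inputGraph f μ 0 z.1 := by rw [inputs, hai, bits_zero]
          rw [← e]
          exact (toList_truncate hs.1).symm
        · subst e2
          have e : inputs f μ a z h = inputGraph f μ 1 z.2.1 := by rw [inputs, haj, bits_one]
          rw [← e]
          exact (toList_truncate hs.2).symm
        · rw [inputs, hao h e1 e2, bits_two]
      rw [Set.mem_ofPred_eq, iSup_inputs f μ hsurj, hrun] at hc
      exact exists_hit_decodeEdge f μ hc
  · have hk' : (4 : ℝ) ≤ k := by exact_mod_cast hk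
    have hL : (0 : ℝ) < L + 1 := by positivity
    have hle : longValid f μ P q V L i 0 + longValid f μ P q V L j 1 ≤ 4 * (b / k) / (L + 1) := by
      have e : 4 * (b / k) / (L + 1) = 2 * (b / (L + 1)) / (k / 2) := by field_simp; ring
      rw [e, le_div_iff₀ (by linarith)]
      have n1 := longValid_nonneg f μ P (V := V) h0.le h1 L i 0
      have n2 := longValid_nonneg f μ P (V := V) h0.le h1 L j 1
      nlinarith
    refine le_trans ?_ hle
    unfold longValid
    rw [← Finset.sum_add_distrib]
    refine Finset.sum_le_sum fun z _ => ?_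
    rw [← mul_add, ← add_mul]
    refine mul_le_mul_of_nonneg_left (mul_le_mul_of_nonneg_right ?_
      (Set.indicator_nonneg (fun _ _ => zero_le_one) _)) (tripleWeight_nonneg h0.le h1 z)
    rw [compl_compl]
    refine (measureReal_union_le _ _).trans (le_of_eq ?_)
    have e1 : inputs f μ a z i = inputGraph f μ 0 (bits z 0) := by rw [inputs, hai]
    have e2 : inputs f μ a z j = inputGraph f μ 1 (bits z 1) := by rw [inputs, haj]
    rw [e1, e2]
    rfl

end Reduction

/-! ### The lower bounds in terms of the scale of the graph -/

-- the instance `Fintype` on triples of families of bits exceeds the default size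
set_option synthInstance.maxSize 1000

section Cost

variable {D s p n m k : ℕ} (f : Vertex D (s ^ 2) p ↪ Fin n) {ε d δ : ℝ}

/-- The number of edges of the player of class `t`, when there are `m` edges in total. -/
def classSize (m : ℕ) (t : Fin 3) : ℕ := if t = 2 then m - 2 * (m / 3) else m / 3

lemma div_three_le_classSize (m : ℕ) (t : Fin 3) : m / 3 ≤ classSize m t := by
  unfold classSize
  split_ifs <;> omega

lemma classSize_le (m : ℕ) (t : Fin 3) : classSize m t ≤ m := by
  unfold classSize
  split_ifs <;> omega

lemma sum_classSize (m : ℕ) : ∑ t, classSize m t = m := by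
  simp only [Fin.sum_univ_three, classSize]
  simp
  omega

/-- The random bits give a graph with at most `m / 3` edges in each class, which leaves room for
padding, and with many edge-disjoint triangles. -/
def ValidBits (D s m : ℕ) (z : (CoreEdge D (s ^ 2) → Bool) × (CoreEdge D (s ^ 2) → Bool) ×
    (CoreEdge D (s ^ 2) → Bool)) : Prop :=
  (Finset.univ.filter fun e => z.1 e = true).card ≤ m / 3 ∧
    (Finset.univ.filter fun e => z.2.1 e = true).card ≤ m / 3 ∧
    (Finset.univ.filter fun e => z.2.2 e = true).card ≤ m / 3 ∧
    (6 : ℝ) ^ D * s ^ 3 / 4000 ≤ (isolatedTriangles z).card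

lemma card_block (D : ℕ) : Fintype.card (Block D) = 6 ^ D := by
  simp

lemma prob_validBits_ge (hs : 100 ≤ s) (hm : 4 * 6 ^ D * s ^ 3 ≤ m) :
    6 / 10 ≤ ∑ z, tripleWeight (1 / (10 * s : ℝ)) z *
      {z | ValidBits D s m z}.indicator 1 z := by
  classical
  have hs' : (100 : ℝ) ≤ s := by exact_mod_cast hs
  have hs0 : (0 : ℝ) < s := by linarith
  have hM : (1 : ℝ) ≤ 6 ^ D := one_le_pow₀ (by norm_num)
  have hs3 : (100 : ℝ) ^ 3 ≤ s ^ 3 := by gcongr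
  have hMs : (1000000 : ℝ) ≤ 6 ^ D * s ^ 3 := by nlinarith
  have hm' : 4 * (6 : ℝ) ^ D * s ^ 3 ≤ m := by exact_mod_cast hm
  have hcard : (Fintype.card (CoreEdge D (s ^ 2)) : ℝ) = 6 ^ D * s ^ 4 := by
    rw [Fintype.card_prod, Fintype.card_prod, card_block, Fintype.card_fin]
    push_cast
    ring
  have hcardT : (Fintype.card (Block D × Fin (s ^ 2) × Fin (s ^ 2) × Fin (s ^ 2)) : ℝ)
      = 6 ^ D * s ^ 6 := by
    rw [Fintype.card_prod, Fintype.card_prod, Fintype.card_prod, card_block, Fintype.card_fin]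
    push_cast
    ring
  have ht : (6 : ℝ) ^ D * s ^ 6 * (1 / (10 * s : ℝ)) ^ 3 = 6 ^ D * s ^ 3 / 1000 := by
    field_simp
    norm_num
  have h := prob_valid_ge (I := Block D) (R := Fin (s ^ 2)) (q := 1 / (10 * s : ℝ))
    (by positivity) (by rw [div_le_one (by positivity)]; linarith)
    (by rw [Fintype.card_fin]; push_cast; field_simp; norm_num)
    (by rw [hcardT, ht]; linarith) (m / 3) (by
      have e : 12 * ((Fintype.card (CoreEdge D (s ^ 2)) : ℝ) * (1 / (10 * s : ℝ)))
          = 12 / 10 * (6 ^ D * s ^ 3) := by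
        rw [hcard]
        field_simp
      rw [e]
      have h1 : m ≤ 3 * (m / 3) + 2 := by omega
      have h2 : (m : ℝ) ≤ 3 * ((m / 3 : ℕ) : ℝ) + 2 := by exact_mod_cast h1
      linarith)
  refine h.trans (le_of_eq (Finset.sum_congr rfl fun z _ => ?_))
  congr 1
  rw [Set.indicator_apply, hcardT, ht]
  have e : (6 : ℝ) ^ D * s ^ 3 / 1000 / 4 = 6 ^ D * s ^ 3 / 4000 := by ring
  rw [e]
  exact if_congr Iff.rfl rfl rfl

/-- Valid bits give valid inputs, for every assignment of the classes to the players. The constant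
`1 / 128000` is the ratio of the number `6 ^ D * s ^ 3 / 4000` of edge-disjoint triangles to the
largest number `32 * 6 ^ D * s ^ 3` of edges. -/
lemma inputs_mem_valid (hn : 0 < n) (hm : m ≤ 32 * 6 ^ D * s ^ 3) (hp : m ≤ p * p)
    (hd : (n : ℝ) * d = 2 * m) (hε : ε ≤ 1 / 128000) {a : Fin k → Fin 3}
    (ha : Function.Surjective a) {z : (CoreEdge D (s ^ 2) → Bool) × (CoreEdge D (s ^ 2) → Bool) ×
      (CoreEdge D (s ^ 2) → Bool)} (hz : ValidBits D s m z) :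
    inputs f (classSize m) a z ∈ (triangleEdgeTask k n ε d).valid := by
  obtain ⟨h0, h1, h2, h3⟩ := hz
  have hn' : (0 : ℝ) < n := by exact_mod_cast hn
  have hbits : ∀ t, (Finset.univ.filter fun e => bits z t e = true).card ≤ m / 3 := by
    intro t
    fin_cases t
    · exact h0
    · exact h1
    · exact h2
  have hedges : (unionGraph f fun t => slots p (classSize m t) (bits z t)).edgeSet.ncard = m := by
    rw [ncard_edgeSet_unionGraph]
    conv_rhs => rw [← sum_classSize m]
    exact Finset.sum_congr rfl fun t _ => card_slots
      ((hbits t).trans (div_three_le_classSize m t)) ((classSize_le m t).trans hp)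
  change avgDegree (⨆ h, inputs f (classSize m) a z h) = d ∧
    FarFromTriFree ε (⨆ h, inputs f (classSize m) a z h)
  rw [iSup_inputs f (classSize m) ha]
  refine ⟨?_, fun H hH => ?_⟩
  · rw [avgDegree, hedges, ← hd]
    field_simp
  · rw [hedges]
    have hiso : ((isolatedTriangles z).card : ℝ) ≤ _ :=
      Nat.cast_le.2 (card_isolatedTriangles_le f (classSize m) z hH)
    have hm' : (m : ℝ) ≤ 32 * 6 ^ D * s ^ 3 := by exact_mod_cast hm
    have : ε * m ≤ 1 / 128000 * m := mul_le_mul_of_nonneg_right hε (Nat.cast_nonneg m)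
    refine le_trans ?_ hiso
    linarith

lemma le_simCC_of_forall {X Y : Type} {T : SearchProblem k X Y} {B : ℝ}
    (h : ∀ P : SimProtocol k X Y, P.Solves T δ →
      ¬ ∀ x ∈ T.valid, P.expectedBits x ≤ ENNReal.ofReal B) :
    ENNReal.ofReal B ≤ simCC T δ := by
  refine le_iInf₂ fun P hP => ?_
  by_contra hcon
  push Not at hcon
  exact h P hP fun x hx => (le_iSup₂ (f := fun x (_ : x ∈ T.valid) => P.expectedBits x) x hx).trans
    hcon.le

/-- The lower bound for three players. Messages of more than `s / 40` bits are treated as failures,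
which by Markov's inequality happen with probability at most `1 / 10`. -/
lemma le_simCC_three (f : Vertex D (s ^ 2) p ↪ Fin n) (hs : 100 ≤ s) (hn : 0 < n)
    (hm : 4 * 6 ^ D * s ^ 3 ≤ m) (hm' : m ≤ 32 * 6 ^ D * s ^ 3)
    (hp : m ≤ p * p) (hd : (n : ℝ) * d = 2 * m) (hε : ε ≤ 1 / 128000) (hδ : δ < 1 / 100) :
    ENNReal.ofReal (s / 400) ≤ simCC (triangleEdgeTask 3 n ε d) δ := by
  refine le_simCC_of_forall fun P hP hcost => ?_
  have hs' : (100 : ℝ) ≤ s := by exact_mod_cast hs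
  have hs0 : (0 : ℝ) < s := by linarith
  have : NeZero (s ^ 2) := ⟨by positivity⟩
  have : Nonempty (CoreEdge D (s ^ 2)) := ⟨(fun _ => (0, false), 0, 0)⟩
  have hV : ∀ z, ValidBits D s m z →
      inputs f (classSize m) id z ∈ (triangleEdgeTask 3 n ε d).valid :=
    fun z hz => inputs_mem_valid f hn hm' hp hd hε Function.surjective_id hz
  have hL1 : ((s / 40 : ℕ) : ℝ) + 1 ≤ s / 20 := by
    have : 20 * (s / 40 + 1) ≤ s := by omega
    have : (20 : ℝ) * (((s / 40 : ℕ) : ℝ) + 1) ≤ s := by exact_mod_cast this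
    linarith
  have hL2 : (s : ℝ) / 40 ≤ ((s / 40 : ℕ) : ℝ) + 1 := by
    have : s ≤ 40 * (s / 40 + 1) := by omega
    have : (s : ℝ) ≤ 40 * (((s / 40 : ℕ) : ℝ) + 1) := by exact_mod_cast this
    linarith
  have hq : 1 / (10 * s : ℝ) ≤ 1 / 1000 := by
    rw [div_le_div_iff₀ (by positivity) (by norm_num)]; linarith
  have hqL : 1 / (10 * s : ℝ) * (((s / 40 : ℕ) : ℝ) + 1) ≤ 1 / 200 := by
    rw [one_div_mul_eq_div, div_le_iff₀ (by positivity)]; linarith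
  have hqr : (1 / (10 * s : ℝ)) ^ 2 * ((s ^ 2 : ℕ) : ℝ) = 1 / 100 := by
    push_cast; field_simp; norm_num
  have hqL0 : 0 ≤ 1 / (10 * s : ℝ) * (((s / 40 : ℕ) : ℝ) + 1) := by positivity
  have key := prob_valid_le_three (q := 1 / (10 * s : ℝ)) (b := s / 400) f (classSize m) P
    (by positivity) (by linarith) (by positivity) hδ hV hP (fun z hz => hcost _ (hV z hz)) (s / 40)
    (κ := 1 / 1000) (by norm_num)
    ((pow_le_pow_left₀ hqL0 hqL 3).trans (by norm_num))
  have hb : (s : ℝ) / 400 / (((s / 40 : ℕ) : ℝ) + 1) ≤ 1 / 10 := by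
    rw [div_le_iff₀ (by positivity)]; linarith
  have hlow := prob_validBits_ge (D := D) hs hm
  linarith

/-- The lower bound for more than three players. Messages of more than `√s / 4` bits of the two
distinguished players are treated as failures. -/
lemma le_simCC_many (f : Vertex D (s ^ 2) p ↪ Fin n) (hs : 100 ≤ s) (hn : 0 < n)
    (hm : 4 * 6 ^ D * s ^ 3 ≤ m) (hm' : m ≤ 32 * 6 ^ D * s ^ 3)
    (hp : m ≤ p * p) (hd : (n : ℝ) * d = 2 * m) (hε : ε ≤ 1 / 128000) (hδ : δ < 1 / 100)
    (hk : 3 < k) :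
    ENNReal.ofReal (k * (Nat.sqrt s / 200)) ≤ simCC (triangleEdgeTask k n ε d) δ := by
  refine le_simCC_of_forall fun P hP hcost => ?_
  have hs' : (100 : ℝ) ≤ s := by exact_mod_cast hs
  have hs0 : (0 : ℝ) < s := by linarith
  have : NeZero (s ^ 2) := ⟨by positivity⟩
  have : Nonempty (CoreEdge D (s ^ 2)) := ⟨(fun _ => (0, false), 0, 0)⟩
  have hV : ∀ a : Fin k → Fin 3, Function.Surjective a → ∀ z, ValidBits D s m z →
      inputs f (classSize m) a z ∈ (triangleEdgeTask k n ε d).valid :=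
    fun a ha z hz => inputs_mem_valid f hn hm' hp hd hε ha hz
  have hk0 : (0 : ℝ) < k := by exact_mod_cast (by omega : 0 < k)
  set w := Nat.sqrt s with hw
  have hw10 : 10 ≤ w := Nat.le_sqrt.2 (by omega)
  have hw10' : (10 : ℝ) ≤ w := by exact_mod_cast hw10
  have hws : (w : ℝ) * w ≤ s := by exact_mod_cast Nat.sqrt_le s
  have hL1 : ((w / 4 : ℕ) : ℝ) + 1 ≤ w / 2 := by
    have : 2 * (w / 4 + 1) ≤ w := by omega
    have : (2 : ℝ) * (((w / 4 : ℕ) : ℝ) + 1) ≤ w := by exact_mod_cast this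
    linarith
  have hL2 : (w : ℝ) / 4 ≤ ((w / 4 : ℕ) : ℝ) + 1 := by
    have : w ≤ 4 * (w / 4 + 1) := by omega
    have : (w : ℝ) ≤ 4 * (((w / 4 : ℕ) : ℝ) + 1) := by exact_mod_cast this
    linarith
  set l : ℝ := ((w / 4 : ℕ) : ℝ) + 1 with hl
  have hl0 : 0 < l := by positivity
  have hq : 1 / (10 * s : ℝ) ≤ 1 / 1000 := by
    rw [div_le_div_iff₀ (by positivity) (by norm_num)]; linarith
  have hqL : 1 / (10 * s : ℝ) * l ≤ 1 / 200 := by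
    rw [one_div_mul_eq_div, div_le_iff₀ (by positivity)]; nlinarith
  have hqLL : 1 / (10 * s : ℝ) * l ^ 2 ≤ 1 / 40 := by
    rw [one_div_mul_eq_div, div_le_iff₀ (by positivity)]; nlinarith
  have hqr : (1 / (10 * s : ℝ)) ^ 2 * ((s ^ 2 : ℕ) : ℝ) = 1 / 100 := by
    push_cast; field_simp; norm_num
  have : Nonempty (Fin (s ^ 2)) := ⟨0⟩
  have key := prob_valid_le_many (q := 1 / (10 * s : ℝ)) (b := k * (w / 200)) f (classSize m) P
    (by positivity) (by linarith) (by positivity) hk hδ hV hP hcost (w / 4)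
  rw [← hl, mul_div_cancel_left₀ _ hk0.ne'] at key
  have hb : 4 * ((w : ℝ) / 200) / l ≤ 8 / 100 := by
    rw [div_le_iff₀ hl0]; linarith
  have hlow := prob_validBits_ge (D := D) hs hm
  linarith

end Cost

section Parameters

/-- The number `m` of edges determines the scale `s`, up to a constant factor. -/
lemma exists_scale {M m : ℕ} (hM : 1 ≤ M) (hm : 4 * M * 100 ^ 3 ≤ m) :
    ∃ s, 100 ≤ s ∧ 4 * M * s ^ 3 ≤ m ∧ m ≤ 32 * M * s ^ 3 := by
  obtain ⟨s, h1, h2⟩ : ∃ s, 4 * M * s ^ 3 ≤ m ∧ m < 4 * M * (s + 1) ^ 3 := by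
    by_contra hcon
    push Not at hcon
    have hall : ∀ s, 4 * M * s ^ 3 ≤ m := fun s => by
      induction s with
      | zero => simp
      | succ s ih => exact hcon s ih
    have h1 := hall (m + 1)
    have h2 : m + 1 ≤ (m + 1) ^ 3 := Nat.le_self_pow (by norm_num) _
    nlinarith
  have hs : 100 ≤ s := by
    by_contra hcon
    have h3 : (s + 1) ^ 3 ≤ 100 ^ 3 := Nat.pow_le_pow_left (by omega) 3
    have := Nat.mul_le_mul_left (4 * M) h3
    omega
  refine ⟨s, hs, h1, ?_⟩
  have h3 : (s + 1) ^ 3 ≤ (2 * s) ^ 3 := Nat.pow_le_pow_left (by omega) 3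
  have := Nat.mul_le_mul_left (4 * M) h3
  have e : 4 * M * (2 * s) ^ 3 = 32 * M * s ^ 3 := by ring
  omega

/-- The dimension `D` is so large that the blocks and the padding fit into `n` vertices. -/
lemma card_vertex_le {C : ℝ} (hC : 0 < C) {D s m n : ℕ} (hD : (3 / 4 : ℝ) ^ D * C ^ 2 ≤ 8 / 27)
    (hm0 : 1 ≤ m) (hs : 4 * 6 ^ D * s ^ 3 ≤ m) (hm : 2 * (m : ℝ) ≤ C * (n * √n))
    (hn : C * (128 * C) ^ 3 ≤ 2 * m) :
    Fintype.card (Vertex D (s ^ 2) (Nat.sqrt m + 1)) ≤ n := by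
  have hn0 : (0 : ℝ) ≤ n := Nat.cast_nonneg n
  have hsq : √(n : ℝ) * √n = n := Real.mul_self_sqrt hn0
  have hroot : 128 * C ≤ √n := by
    have h1 : C * (128 * C) ^ 3 ≤ C * √n ^ 3 := by
      refine (hn.trans hm).trans (le_of_eq ?_)
      linear_combination (- C * √n) * hsq
    exact le_of_pow_le_pow_left₀ (by norm_num) (Real.sqrt_nonneg _) (le_of_mul_le_mul_left h1 hC)
  -- the blocks take up at most half of the vertices: compare cubes, and square `8 * 6 ^ D * s ^ 3`
  have hcore : 2 * (3 * 3 ^ D * (s : ℝ) ^ 2) ≤ n := by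
    refine le_of_pow_le_pow_left₀ (n := 3) (by norm_num) hn0 ?_
    have h1 : 4 * (6 : ℝ) ^ D * s ^ 3 ≤ m := by exact_mod_cast hs
    have h2 : 8 * (6 : ℝ) ^ D * s ^ 3 ≤ C * (n * √n) := by linarith
    have h3 := pow_le_pow_left₀ (by positivity) h2 2
    have e1 : (8 * (6 : ℝ) ^ D * s ^ 3) ^ 2 = 64 * 36 ^ D * s ^ 6 := by
      rw [mul_pow, mul_pow, ← pow_mul, mul_comm D 2, pow_mul]; norm_num; ring
    have e2 : (C * (n * √n)) ^ 2 = C ^ 2 * (n : ℝ) ^ 3 := by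
      linear_combination (C ^ 2 * (n : ℝ) ^ 2) * hsq
    rw [e1, e2] at h3
    have h4 := mul_le_mul_of_nonneg_left h3 (by positivity : (0 : ℝ) ≤ (3 / 4) ^ D)
    have h5 := mul_le_mul_of_nonneg_right hD (by positivity : (0 : ℝ) ≤ (n : ℝ) ^ 3)
    have e3 : (3 / 4 : ℝ) ^ D * (64 * 36 ^ D * s ^ 6) = 64 * (27 ^ D * s ^ 6) := by
      have : (27 : ℝ) ^ D = (3 / 4) ^ D * 36 ^ D := by rw [← mul_pow]; norm_num
      rw [this]; ring
    have e4 : (2 * (3 * 3 ^ D * (s : ℝ) ^ 2)) ^ 3 = 216 * (27 ^ D * s ^ 6) := by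
      have : (27 : ℝ) ^ D = (3 ^ D) ^ 3 := by rw [← pow_mul, mul_comm D 3, pow_mul]; norm_num
      rw [this]; ring
    rw [e4]
    rw [e3] at h4
    linarith
  -- the padding vertices take up at most the other half
  have hpad : 2 * (4 * ((Nat.sqrt m : ℝ) + 1)) ≤ n := by
    refine le_of_pow_le_pow_left₀ (n := 2) (by norm_num) hn0 ?_
    have h1 : (Nat.sqrt m : ℝ) * Nat.sqrt m ≤ m := by exact_mod_cast Nat.sqrt_le m
    have h2 : (1 : ℝ) ≤ Nat.sqrt m := by exact_mod_cast Nat.le_sqrt.2 (by omega : 1 * 1 ≤ m)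
    have h3 : 128 * C * (n * √n) ≤ (n : ℝ) ^ 2 := by
      have := mul_le_mul_of_nonneg_right hroot (by positivity : (0 : ℝ) ≤ n * √n)
      refine this.trans (le_of_eq ?_)
      linear_combination (n : ℝ) * hsq
    nlinarith
  have hfin : ((3 * 3 ^ D * s ^ 2 + 4 * (Nat.sqrt m + 1) : ℕ) : ℝ) ≤ n := by
    push_cast
    linarith
  have hcard : Fintype.card (Vertex D (s ^ 2) (Nat.sqrt m + 1))
      = 3 * 3 ^ D * s ^ 2 + 4 * (Nat.sqrt m + 1) := by
    simp only [Fintype.card_sum, Fintype.card_prod, Fintype.card_fin, Fintype.card_fun]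
    ring
  rw [hcard]
  exact_mod_cast hfin

lemma rpow_one_div_le {x y : ℝ} (hx : 0 ≤ x) (hy : 0 ≤ y) {j : ℕ} (hj : j ≠ 0) (h : x ≤ y ^ j) :
    x ^ (1 / j : ℝ) ≤ y := by
  rw [one_div]
  calc x ^ ((j : ℝ)⁻¹) ≤ (y ^ j) ^ ((j : ℝ)⁻¹) := Real.rpow_le_rpow hx h (by positivity)
    _ = y := Real.pow_rpow_inv_natCast hy hj

end Parameters

end TriangleEdge

open TriangleEdge in
theorem mainTheorem1 :
    ∃ ε₀ : ℝ, 0 < ε₀ ∧ ∀ C : ℝ, 0 < C → ∃ c : ℝ, 0 < c ∧ ∃ N : ℝ,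
      ∀ (n : ℕ) (d : ℝ), N ≤ n * d → d ≤ C * √(n : ℝ) → (∃ m : ℕ, (n : ℝ) * d = 2 * m) →
        ∀ ε δ : ℝ, 0 < ε → ε ≤ ε₀ → δ < 1 / 100 →
          (∀ k : ℕ, 3 < k →
            ENNReal.ofReal (c * (k * ((n : ℝ) * d) ^ (1 / 6 : ℝ)))
              ≤ simCC (triangleEdgeTask k n ε d) δ) ∧
          ENNReal.ofReal (c * ((n : ℝ) * d) ^ (1 / 3 : ℝ))
            ≤ simCC (triangleEdgeTask 3 n ε d) δ := by
  refine ⟨1 / 128000, by norm_num, fun C hC => ?_⟩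
  obtain ⟨D, hD⟩ : ∃ D : ℕ, (3 / 4 : ℝ) ^ D < 8 / 27 / C ^ 2 :=
    exists_pow_lt_of_lt_one (by positivity) (by norm_num)
  rw [lt_div_iff₀ (by positivity)] at hD
  have hM : (1 : ℝ) ≤ 6 ^ D := one_le_pow₀ (by norm_num)
  -- the first bound on `n * d` makes the scale `s` at least `100`, the second one leaves room for
  -- the padding
  refine ⟨1 / (1600 * 6 ^ D), by positivity, max (8 * 6 ^ D * 100 ^ 3) (C * (128 * C) ^ 3), ?_⟩
  rintro n d hN hdC ⟨m, hd⟩ ε δ - hε hδ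
  rw [hd] at hN ⊢
  have hm1 : 4 * 6 ^ D * 100 ^ 3 ≤ m := by
    have := (le_max_left _ _).trans hN
    have : (4 : ℝ) * 6 ^ D * 100 ^ 3 ≤ m := by linarith
    exact_mod_cast this
  have hm0 : 1 ≤ m := le_trans (Nat.one_le_iff_ne_zero.2 (by positivity)) hm1
  have hn : 0 < n := by
    rcases Nat.eq_zero_or_pos n with rfl | h
    · exfalso
      have : (1 : ℝ) ≤ m := by exact_mod_cast hm0
      rw [Nat.cast_zero, zero_mul] at hd
      linarith
    · exact h
  have hmC : 2 * (m : ℝ) ≤ C * (n * √n) := by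
    rw [← hd]
    have := mul_le_mul_of_nonneg_left hdC (Nat.cast_nonneg (α := ℝ) n)
    linarith
  obtain ⟨s, hs, hs1, hs2⟩ := exists_scale (Nat.one_le_pow _ _ (by norm_num)) hm1
  obtain ⟨f⟩ : Nonempty (Vertex D (s ^ 2) (Nat.sqrt m + 1) ↪ Fin n) :=
    Function.Embedding.nonempty_of_card_le (by
      rw [Fintype.card_fin]
      exact card_vertex_le hC hD.le hm0 hs1 hmC ((le_max_right _ _).trans hN))
  have hp : m ≤ (Nat.sqrt m + 1) * (Nat.sqrt m + 1) := (Nat.lt_succ_sqrt m).le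
  have hs2' : (m : ℝ) ≤ 32 * 6 ^ D * s ^ 3 := by exact_mod_cast hs2
  have hm2 : (0 : ℝ) ≤ 2 * m := by positivity
  constructor
  · intro k hk
    refine le_trans (ENNReal.ofReal_le_ofReal ?_)
      (le_simCC_many f hs hn hs1 hs2 hp hd hε hδ hk)
    set w := Nat.sqrt s with hw
    have hsw : (s : ℝ) ≤ 4 * w ^ 2 := by
      have h1 : s < (w + 1) * (w + 1) := Nat.lt_succ_sqrt s
      have h2 : 1 ≤ w := Nat.le_sqrt.2 (by omega)
      have h3 : s ≤ 4 * w ^ 2 := by nlinarith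
      exact_mod_cast h3
    have hroot : (2 * (m : ℝ)) ^ (1 / 6 : ℝ) ≤ 4 * 6 ^ D * w := by
      refine rpow_one_div_le (j := 6) hm2 (by positivity) (by norm_num) ?_
      have h3 : (s : ℝ) ^ 3 ≤ (4 * w ^ 2) ^ 3 := by gcongr
      have h4 : (6 : ℝ) ^ D ≤ (6 ^ D) ^ 6 := le_self_pow₀ hM (by norm_num)
      calc 2 * (m : ℝ) ≤ 64 * 6 ^ D * s ^ 3 := by linarith
        _ ≤ 64 * (6 ^ D) ^ 6 * (4 * w ^ 2) ^ 3 := by gcongr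
        _ = (4 * 6 ^ D * w) ^ 6 := by ring
    calc 1 / (1600 * 6 ^ D) * (k * (2 * (m : ℝ)) ^ (1 / 6 : ℝ))
        ≤ 1 / (1600 * 6 ^ D) * (k * (4 * 6 ^ D * w)) := by gcongr
      _ = k * (w / 400) := by field_simp; ring
      _ ≤ k * (w / 200) := by gcongr; norm_num
  · refine le_trans (ENNReal.ofReal_le_ofReal ?_)
      (le_simCC_three f hs hn hs1 hs2 hp hd hε hδ)
    have hroot : (2 * (m : ℝ)) ^ (1 / 3 : ℝ) ≤ 4 * 6 ^ D * s := by
      refine rpow_one_div_le (j := 3) hm2 (by positivity) (by norm_num) ?_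
      have h4 : (6 : ℝ) ^ D ≤ (6 ^ D) ^ 3 := le_self_pow₀ hM (by norm_num)
      calc 2 * (m : ℝ) ≤ 64 * 6 ^ D * s ^ 3 := by linarith
        _ ≤ 64 * (6 ^ D) ^ 3 * s ^ 3 := by gcongr
        _ = (4 * 6 ^ D * s) ^ 3 := by ring
    calc 1 / (1600 * 6 ^ D) * (2 * (m : ℝ)) ^ (1 / 3 : ℝ)
        ≤ 1 / (1600 * 6 ^ D) * (4 * 6 ^ D * s) := by gcongr
      _ = s / 400 := by field_simp; norm_num
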